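/- An \emph{election} consists of a finite set $V$ of $n$ voters, a finite set $C$ of $m$ candidates, an approval set $A_v\subseteq C$ for every voter $v\in V$, and a target committee size $k\in\{1,\dots,m\}$. It belongs to the \emph{voter-candidate interval (VCI) domain} if there are positions $x_c,x_v\in\mathbb R$ and radii $r_c,r_v\ge 0$ (for all $c\in C$, $v\in V$) such that $c\in A_v$ if and only if $|x_c-x_v|\le r_c+r_v$, for all $v\in V$ and $c\in C$. For $W\subseteq C$, two voters $u,v$ are \emph{connected by} $W$ if there is a sequence of voters $u=v_0,v_1,\dots,v_s=v$ with $A_{v_{i-1}}\cap A_{v_i}\cap W\neq\emptyset$ for all $i\in\{1,\dots,s\}$. Let $\mathrm{Cons}(W)$ be the number of unordered pairs $\{u,v\}$ of distinct voters that are connected by $W$. \textbf{Theorem.} There is a polynomial-time algorithm which, given an election in the VCI domain (the approval sets and $k$ only; positions and radii are not part of the input), outputs a committee $W\subseteq C$ with $|W|=k$ such that $\mathrm{Cons}(W)\ge \mathrm{Cons}(W')$ for all $W'\subseteq C$ with $|W'|\le k$. Here polynomial time means: there are a single random access machine program (unit-cost steps; natural-number registers and arrays; the only arithmetic operations are addition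 and truncated subtraction) and a single polynomial $p$ such that on every election in the VCI domain with $n$ voters and $m$ candidates, given by $n$, $m$, $k$ and the $n\times m$ approval matrix, the program halts with such a $W$ after at most $p(n+m)$ steps. -/

import Mathlib

/-- An approval-based multiwinner election with voter set `V` and candidate set `C`:
`A v` is the set of candidates approved by voter `v`, and `k ∈ {1, …, |C|}` is the
target committee size. -/
structure Election (V C : Type*) [Fintype C] where
  A : V → Finset C
  k : ℕ
  one_le_k : 1 ≤ k
  k_le : k ≤ Fintype.card C

namespace Election

variable {V C : Type*} [Fintype C]

/-- The voter-candidate interval domain: voters and candidates have positions and nonnegative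
radii on the real line such that a voter approves a candidate exactly if their intervals meet. -/
def IsVCI (E : Election V C) : Prop :=
  ∃ (xC : C → ℝ) (xV : V → ℝ) (rC : C → ℝ) (rV : V → ℝ),
    (∀ c, 0 ≤ rC c) ∧ (∀ v, 0 ≤ rV v) ∧
      ∀ v c, c ∈ E.A v ↔ |xC c - xV v| ≤ rC c + rV v

/-- `u` and `v` jointly approve a member of `W`, that is, `A u ∩ A v ∩ W ≠ ∅`. -/
def Linked (E : Election V C) (W : Finset C) (u v : V) : Prop :=
  ∃ c ∈ W, c ∈ E.A u ∧ c ∈ E.A v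

/-- `u` and `v` are connected by `W`: there is a finite sequence of voters from `u` to `v` in
which any two consecutive voters jointly approve a member of `W`. -/
def Connected (E : Election V C) (W : Finset C) (u v : V) : Prop :=
  Relation.ReflTransGen (E.Linked W) u v

/-- The number of unordered pairs of distinct voters that are connected by `W`. -/
noncomputable def cons (E : Election V C) (W : Finset C) : ℕ :=
  Set.ncard {p : Sym2 V | ∃ u v : V, u ≠ v ∧ p = s(u, v) ∧ E.Connected W u v}

/-- `W` has exactly `k` members, and no committee (set of at most `k` candidates) connects
more pairs of voters. -/
def IsConsMaximizing (E : Election V C) (W : Finset C) : Prop :=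
  W.card = E.k ∧ ∀ W' : Finset C, W'.card ≤ E.k → E.cons W' ≤ E.cons W

end Election

/-! A random access machine with structured control. The memory consists of natural-number
variables and natural-number arrays; a program mentions finitely many of them by name. The only
arithmetic operations are addition and truncated subtraction, each charged one step, so that one
step lengthens the binary representation of the largest number in memory by at most one bit (up to
the constants of the program). Hence polynomially many steps of this machine amount to
polynomial time on a Turing machine, and conversely. -/
namespace RAM

/-- A memory content: `var x` is the value of the variable named `x`, and `arr a i` is the entry
with index `i` of the array named `a`. -/
structure State where
  var : ℕ → ℕ
  arr : ℕ → ℕ → ℕ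

/-- Expressions: constants, variables, array entries, sums and truncated differences. -/
inductive Exp where
  | const (c : ℕ)
  | var (x : ℕ)
  | get (a : ℕ) (i : Exp)
  | add (e f : Exp)
  | sub (e f : Exp)

/-- The value of an expression. -/
def Exp.eval (s : State) : Exp → ℕ
  | const c => c
  | var x => s.var x
  | get a i => s.arr a (i.eval s)
  | add e f => e.eval s + f.eval s
  | sub e f => e.eval s - f.eval s

/-- The number of steps charged for the evaluation of an expression: one for every node. -/
def Exp.cost : Exp → ℕ
  | const _ => 1
  | var _ => 1
  | get _ i => i.cost + 1
  | add e f => e.cost + f.cost + 1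
  | sub e f => e.cost + f.cost + 1

/-- Programs: the empty program, assignment `x := e`, array assignment `a[i] := e`, sequential
composition, branching on whether `e ≠ 0`, and the loop "while `e ≠ 0` do `p`". -/
inductive Prog where
  | skip
  | assign (x : ℕ) (e : Exp)
  | put (a : ℕ) (i e : Exp)
  | seq (p q : Prog)
  | ite (e : Exp) (p q : Prog)
  | loop (e : Exp) (p : Prog)

/-- `State.setVar s x y`: the variable `x` is overwritten with the value `y`. -/
def State.setVar (s : State) (x y : ℕ) : State :=
  { s with var := Function.update s.var x y }

/-- `State.setArr s a i y`: the entry `i` of the array `a` is overwritten with the value `y`. -/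
def State.setArr (s : State) (a i y : ℕ) : State :=
  { s with arr := Function.update s.arr a (Function.update (s.arr a) i y) }

/-- `Exec p s s' t`: the program `p`, started in memory `s`, halts with memory `s'` after exactly
`t` steps. -/
inductive Exec : Prog → State → State → ℕ → Prop
  | skip (s : State) : Exec .skip s s 1
  | assign (s : State) (x : ℕ) (e : Exp) :
      Exec (.assign x e) s (s.setVar x (e.eval s)) (e.cost + 1)
  | put (s : State) (a : ℕ) (i e : Exp) :
      Exec (.put a i e) s (s.setArr a (i.eval s) (e.eval s)) (i.cost + e.cost + 1)
  | seq {p q : Prog} {s s' s'' : State} {t t' : ℕ} :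
      Exec p s s' t → Exec q s' s'' t' → Exec (.seq p q) s s'' (t + t')
  | ite_true {e : Exp} {p q : Prog} {s s' : State} {t : ℕ} :
      e.eval s ≠ 0 → Exec p s s' t → Exec (.ite e p q) s s' (e.cost + 1 + t)
  | ite_false {e : Exp} {p q : Prog} {s s' : State} {t : ℕ} :
      e.eval s = 0 → Exec q s s' t → Exec (.ite e p q) s s' (e.cost + 1 + t)
  | loop_stop {e : Exp} {p : Prog} {s : State} :
      e.eval s = 0 → Exec (.loop e p) s s (e.cost + 1)
  | loop_step {e : Exp} {p : Prog} {s s' s'' : State} {t t' : ℕ} :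
      e.eval s ≠ 0 → Exec p s s' t → Exec (.loop e p) s' s'' t' →
        Exec (.loop e p) s s'' (e.cost + 1 + t + t')

end RAM

namespace Election

/-- The input memory of an election with voters `0, …, n - 1` and candidates `0, …, m - 1`:
the variables `0, 1, 2` hold `n, m, k`, and the array `0` holds the `n × m` approval matrix row
by row (the entry with index `v * m + c` is `1` if `v` approves `c`, and `0` otherwise).
Everything else is `0`. -/
def input {n m : ℕ} (E : Election (Fin n) (Fin m)) : RAM.State where
  var x := if x = 0 then n else if x = 1 then m else if x = 2 then E.k else 0
  arr a i :=
    if a = 0 ∧ ∃ (v : Fin n) (c : Fin m), i = (v : ℕ) * m + (c : ℕ) ∧ c ∈ E.A v then 1 else 0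

/-- The set of candidates that a memory content represents as the output of a computation: array
`1` holds its indicator vector. -/
def output (m : ℕ) (s : RAM.State) : Finset (Fin m) :=
  Finset.univ.filter fun c => s.arr 1 (c : ℕ) ≠ 0

end Election

/-! A candidate whose supporters all support another candidate is superfluous: in any committee it
can be replaced by the other one (`Election.exists_subset_kept`). In the voter-candidate interval
domain, the intervals of the remaining, undominated candidates are not nested, so their left
endpoints and their right endpoints yield the same order, and each voter approves consecutive
members of this order (`Election.IsVCI.exists_pos`).

The positions are not known, but an order with this consecutiveness property can be recovered from
the approval sets. If a voter approves `q` and `q'` but not `p`, then `q` and `q'` are on the same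
side of `p` in every such order. This relates the ordered pairs `(p, q)` and `(p, q')`, and the
equivalence classes generated in this way (`Consecutive.Reach`) have to be oriented as a whole. A
class differs from its reverse, and each class is oriented by comparing the largest code of one of
its pairs with that of the reverse class. The resulting relation is transitive: by
`Consecutive.IsConsecutive.reach_outer`, `reach_left` and `reach_right`, a cycle `a`, `b`, `c` would
produce three pairwise disjoint sets of candidates of which the largest members form a cycle of
inequalities (`Consecutive.IsLabel.not_cycle_of_lt`). That voters approve consecutive candidates is
then immediate (`Consecutive.IsLabel.prec_conv`). The largest codes are found by propagation
(`Consecutive.isLabel_of_rounds`).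

Given such an order, committees are built from first to last candidate. When `d` is appended to a
committee with last member `c`, each supporter of `d` that approves an earlier member also approves
`c`. So the only classes of connected voters that can change are the class of the supporters of `c`,
and the increase of the number of connected pairs is determined by `c`, `d` and the size of that
class (`Election.Attaches.cons_insert`, `Election.Ends.insert`). A dynamic program over the number
of members, the last member and the size of the last class therefore computes the largest number of
pairs connected by at most `k` of the marked candidates (`Election.IsTable.succ`,
`Election.IsTable.best_succ`). Starting with all candidates marked, each candidate is unmarked if
this neither decreases this optimum nor leaves fewer than `k` marked candidates. The candidates that
are marked in the end form an optimal committee of size `k`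
(`Election.isConsMaximizing_of_minimal`).

The program is written in a small language with array assignments, loops of length
`N = n + m + 1`, and expressions with sums and maxima over `0, …, N - 1`. Every command of this
language terminates, and it is compiled to the machine with a running time that is bounded by a
polynomial in `N` determined by the command alone (`RAM.Cmd.runs_compile`). Polynomial running time
thus holds by construction, and only the correctness of the command remains to be shown. -/

namespace RAM

/-! ### A bounded-loop language and its translation to the machine -/

/-- Expressions with bounded aggregation. Relative to a bound `N`, `idx e f` is the index
`N * e + f` of the entry `(e, f)` of an array used as a matrix with rows of length `N`, `ite b e f`
is `e` if `b ≠ 0` and `f` otherwise, and `sum x e`, `sup x e` are the sum and the maximum of `e`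
over the values `0, …, N - 1` of the variable `x`. -/
inductive BExp where
  | const (c : ℕ)
  | var (x : ℕ)
  | get (a : ℕ) (i : BExp)
  | add (e f : BExp)
  | sub (e f : BExp)
  | idx (e f : BExp)
  | ite (b e f : BExp)
  | sum (x : ℕ) (e : BExp)
  | sup (x : ℕ) (e : BExp)

/-- The value of an expression relative to the bound `N`. -/
def BExp.eval (N : ℕ) : BExp → State → ℕ
  | const c, _ => c
  | var x, s => s.var x
  | get a i, s => s.arr a (i.eval N s)
  | add e f, s => e.eval N s + f.eval N s
  | sub e f, s => e.eval N s - f.eval N s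
  | idx e f, s => N * e.eval N s + f.eval N s
  | ite b e f, s => if b.eval N s ≠ 0 then e.eval N s else f.eval N s
  | sum x e, s => ∑ i ∈ Finset.range N, e.eval N (s.setVar x i)
  | sup x e, s => (Finset.range N).sup fun i => e.eval N (s.setVar x i)

/-- Commands: array assignment, sequential composition, and the loop `forN x c` that runs `c` for
the values `0, …, N - 1` of `x`. -/
inductive Cmd where
  | put (a : ℕ) (i e : BExp)
  | seq (c d : Cmd)
  | forN (x : ℕ) (c : Cmd)

/-- Apply `f 0, …, f (N - 1)` in this order. -/
def iter {α : Type*} (f : ℕ → α → α) : ℕ → α → α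
  | 0, s => s
  | i + 1, s => f i (iter f i s)

/-- The effect of a command on the memory, relative to the bound `N`. -/
def Cmd.run (N : ℕ) : Cmd → State → State
  | put a i e, s => s.setArr a (i.eval N s) (e.eval N s)
  | seq c d, s => d.run N (c.run N s)
  | forN x c, s => iter (fun i s => c.run N (s.setVar x i)) N s

/-! ### Halting within a time bound -/

/-- `p` started in `s` halts after at most `T` steps in a state that satisfies `Q`. -/
def Runs (p : Prog) (s : State) (T : ℕ) (Q : State → Prop) : Prop :=
  ∃ s' t, Exec p s s' t ∧ t ≤ T ∧ Q s'

theorem Runs.mono {p s T T' Q Q'} (h : Runs p s T Q) (hT : T ≤ T') (hQ : ∀ s', Q s' → Q' s') :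
    Runs p s T' Q' := by
  obtain ⟨s', t, h1, h2, h3⟩ := h
  exact ⟨s', t, h1, h2.trans hT, hQ _ h3⟩

theorem Runs.le {p s T T' Q} (h : Runs p s T Q) (hT : T ≤ T') : Runs p s T' Q :=
  h.mono hT fun _ h => h

theorem Runs.assign {s : State} {x : ℕ} {e : Exp} {Q : State → Prop}
    (h : Q (s.setVar x (e.eval s))) : Runs (.assign x e) s (e.cost + 1) Q :=
  ⟨_, _, .assign s x e, le_rfl, h⟩

theorem Runs.put {s : State} {a : ℕ} {i e : Exp} {Q : State → Prop}
    (h : Q (s.setArr a (i.eval s) (e.eval s))) : Runs (.put a i e) s (i.cost + e.cost + 1) Q :=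
  ⟨_, _, .put s a i e, le_rfl, h⟩

theorem Runs.seq {p q s T T' R Q} (h : Runs p s T R) (h' : ∀ s', R s' → Runs q s' T' Q) :
    Runs (.seq p q) s (T + T') Q := by
  obtain ⟨s', t, h1, h2, h3⟩ := h
  obtain ⟨s'', t', h1', h2', h3'⟩ := h' _ h3
  exact ⟨s'', t + t', .seq h1 h1', by omega, h3'⟩

theorem Runs.ite {e : Exp} {p q s T T' Q} (h : e.eval s ≠ 0 → Runs p s T Q)
    (h' : e.eval s = 0 → Runs q s T' Q) : Runs (.ite e p q) s (e.cost + 1 + (T + T')) Q := by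
  by_cases he : e.eval s = 0
  · obtain ⟨s', t, h1, h2, h3⟩ := h' he
    exact ⟨s', _, .ite_false he h1, by omega, h3⟩
  · obtain ⟨s', t, h1, h2, h3⟩ := h he
    exact ⟨s', _, .ite_true he h1, by omega, h3⟩

/-- The loop that counts the variable `t` up to the bound stored in variable `1`. -/
theorem Runs.loop {t : ℕ} {p : Prog} {N B : ℕ} (I : ℕ → State → Prop)
    (hI : ∀ i s, I i s → s.var 1 = N ∧ s.var t = i)
    (hp : ∀ i < N, ∀ s, I i s → Runs p s B (I (i + 1))) {s : State} (h0 : I 0 s) :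
    Runs (.loop (.sub (.var 1) (.var t)) p) s (N * (B + 4) + 4) (I N) := by
  suffices H : ∀ r i s, i + r = N → I i s →
      Runs (.loop (.sub (.var 1) (.var t)) p) s (r * (B + 4) + 4) (I N) from H N 0 s (by simp) h0
  intro r
  induction r with
  | zero =>
    intro i s hi h
    obtain ⟨h1, h2⟩ := hI i s h
    have : (Exp.sub (.var 1) (.var t)).eval s = 0 := by simp [Exp.eval]; omega
    have hexit : Exec (.loop (.sub (.var 1) (.var t)) p) s s
        ((Exp.sub (.var 1) (.var t)).cost + 1) := by
      constructor
      exact this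
    refine ⟨s, _, hexit, by simp [Exp.cost], ?_⟩
    obtain rfl : i = N := by simpa using hi
    exact h
  | succ r ih =>
    intro i s hi h
    obtain ⟨h1, h2⟩ := hI i s h
    have : (Exp.sub (.var 1) (.var t)).eval s ≠ 0 := by simp [Exp.eval]; omega
    obtain ⟨s', t', e1, e2, e3⟩ := hp i (by omega) s h
    obtain ⟨s'', t'', f1, f2, f3⟩ := ih (i + 1) s' (by omega) e3
    refine ⟨s'', _, .loop_step this e1 f1, ?_, f3⟩
    simp only [Exp.cost]
    rw [Nat.succ_mul]
    omega

/-! ### Compilation -/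

/-- The machine state `σ` represents `s` relative to the bound `N`: arrays coincide, the variable
`x` is stored under the name `2 * x`, and the bound under the name `1`. The names `2 * d + 3` are
left for intermediate results. -/
structure Rep (N : ℕ) (s σ : State) : Prop where
  var : ∀ x, σ.var (2 * x) = s.var x
  arr : σ.arr = s.arr
  bound : σ.var 1 = N

/-- `σ'` represents `s` and has the intermediate results below level `d` of `σ`. -/
structure Keeps (N : ℕ) (s : State) (d : ℕ) (σ σ' : State) : Prop where
  rep : Rep N s σ'
  low : ∀ d' < d, σ'.var (2 * d' + 3) = σ.var (2 * d' + 3)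

/-- The machine variable with the intermediate result of level `d`. -/
abbrev tmp (d : ℕ) : ℕ := 2 * d + 3

/-- The loop that folds the values of a program `p`, which leaves its result in `tmp (d + 3)`,
over the values `0, …, N - 1` of `x`. The accumulator is `tmp d`, the old value of `x` is kept in
`tmp (d + 1)`, and `tmp (d + 2)` counts. -/
def foldProg (d x : ℕ) (upd : Exp) (p : Prog) : Prog :=
  .seq (.assign (tmp (d + 1)) (.var (2 * x))) <| .seq (.assign (tmp d) (.const 0)) <|
    .seq (.assign (tmp (d + 2)) (.const 0)) <| .seq
      (.loop (.sub (.var 1) (.var (tmp (d + 2)))) <|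
        .seq (.assign (2 * x) (.var (tmp (d + 2)))) <| .seq p <| .seq (.assign (tmp d) upd) <|
          .assign (tmp (d + 2)) (.add (.var (tmp (d + 2))) (.const 1)))
      (.assign (2 * x) (.var (tmp (d + 1))))

/-- The program that evaluates an expression into `tmp d` and uses only the intermediate results
from level `d` on. The maximum of `a` and `b` is computed as `a + (b - a)`. -/
def BExp.compile : ℕ → BExp → Prog
  | d, const c => .assign (tmp d) (.const c)
  | d, var x => .assign (tmp d) (.var (2 * x))
  | d, get a i => .seq (i.compile d) (.assign (tmp d) (.get a (.var (tmp d))))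
  | d, add e f => .seq (e.compile d) <| .seq (f.compile (d + 1)) <|
      .assign (tmp d) (.add (.var (tmp d)) (.var (tmp (d + 1))))
  | d, sub e f => .seq (e.compile d) <| .seq (f.compile (d + 1)) <|
      .assign (tmp d) (.sub (.var (tmp d)) (.var (tmp (d + 1))))
  | d, idx e f => .seq (e.compile d) <| .seq (f.compile (d + 1)) <|
      .seq (.assign (tmp (d + 2)) (.const 0)) <| .seq
        (.loop (.sub (.var 1) (.var (tmp (d + 2)))) <| .seq
          (.assign (tmp (d + 1)) (.add (.var (tmp (d + 1))) (.var (tmp d))))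
          (.assign (tmp (d + 2)) (.add (.var (tmp (d + 2))) (.const 1))))
        (.assign (tmp d) (.var (tmp (d + 1))))
  | d, ite b e f => .seq (b.compile d) (.ite (.var (tmp d)) (e.compile d) (f.compile d))
  | d, sum x e => foldProg d x (.add (.var (tmp d)) (.var (tmp (d + 3)))) (e.compile (d + 3))
  | d, sup x e => foldProg d x
      (.add (.var (tmp d)) (.sub (.var (tmp (d + 3))) (.var (tmp d)))) (e.compile (d + 3))

/-- A bound for the running time of the compiled expression, as a polynomial in `N`. -/
noncomputable def BExp.cost : BExp → Polynomial ℕ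
  | const _ => 2
  | var _ => 2
  | get _ i => i.cost + 3
  | add e f => e.cost + f.cost + 4
  | sub e f => e.cost + f.cost + 4
  | idx e f => e.cost + f.cost + (Polynomial.X * 12 + 8)
  | ite b e f => b.cost + (e.cost + f.cost + 2)
  | sum _ e => Polynomial.X * (e.cost + 16) + 12
  | sup _ e => Polynomial.X * (e.cost + 16) + 12

theorem Keeps.refl {N s d σ} (h : Rep N s σ) : Keeps N s d σ σ := ⟨h, fun _ _ => rfl⟩

theorem Keeps.trans {N s d σ σ' σ''} (h : Keeps N s d σ σ') (h' : Keeps N s d σ' σ'') :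
    Keeps N s d σ σ'' := ⟨h'.rep, fun d' hd => (h'.low d' hd).trans (h.low d' hd)⟩

theorem Keeps.mono {N s d d' σ σ'} (h : Keeps N s d σ σ') (hd : d' ≤ d) : Keeps N s d' σ σ' :=
  ⟨h.rep, fun e he => h.low e (he.trans_le hd)⟩

theorem Rep.setTmp {N s σ} (h : Rep N s σ) (d y : ℕ) : Rep N s (σ.setVar (tmp d) y) := by
  refine ⟨fun x => ?_, h.arr, ?_⟩
  · simpa [State.setVar, Function.update, show 2 * x ≠ 2 * d + 3 by omega] using h.var x
  · simpa [State.setVar, Function.update] using h.bound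

theorem Keeps.setTmp {N s d σ σ'} (h : Keeps N s d σ σ') {d' : ℕ} (hd : d ≤ d') (y : ℕ) :
    Keeps N s d σ (σ'.setVar (tmp d') y) := by
  refine ⟨h.rep.setTmp d' y, fun e he => ?_⟩
  simpa [State.setVar, Function.update, show e ≠ d' by omega] using h.low e he

theorem Rep.setUser {N s σ} (h : Rep N s σ) (x y : ℕ) :
    Rep N (s.setVar x y) (σ.setVar (2 * x) y) := by
  refine ⟨fun z => ?_, h.arr, ?_⟩
  · by_cases hz : z = x
    · simp [State.setVar, hz]
    · simpa [State.setVar, Function.update, hz] using h.var z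
  · simpa [State.setVar, Function.update, show 1 ≠ 2 * x by omega] using h.bound

@[simp] theorem setVar_var_self (s : State) (x y : ℕ) : (s.setVar x y).var x = y := by
  simp [State.setVar]

theorem setVar_var_ne (s : State) {x z : ℕ} (y : ℕ) (h : z ≠ x) :
    (s.setVar x y).var z = s.var z := by
  simp [State.setVar, h]

/-- Started in any machine state that represents `s`, the program `p` leaves the value `y` in
`tmp d` within `T` steps and preserves the represented state and the intermediate results below
level `d`. -/
def Computes (N : ℕ) (p : Prog) (d T : ℕ) (s : State) (y : ℕ) : Prop :=
  ∀ σ, Rep N s σ → Runs p σ T fun σ' => Keeps N s d σ σ' ∧ σ'.var (tmp d) = y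

/-- `foldProg` iterates the binary operation `op` that is expressed by `upd`; `g i` is the
accumulated value of the first `i` values of `f`. -/
theorem Computes.foldProg {N d x T : ℕ} {s : State} {upd : Exp} {p : Prog} {f : ℕ → ℕ}
    (hp : ∀ i < N, Computes N p (d + 3) T (s.setVar x i) (f i)) (op : ℕ → ℕ → ℕ)
    (hupd : ∀ σ, upd.eval σ = op (σ.var (tmp d)) (σ.var (tmp (d + 3)))) (hc : upd.cost ≤ 5)
    (g : ℕ → ℕ) (hg0 : g 0 = 0) (hg : ∀ i, g (i + 1) = op (g i) (f i)) :
    Computes N (foldProg d x upd p) d (N * (T + 16) + 12) s (g N) := by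
  intro σ hσ
  have key : ∀ y σ', Keeps N (s.setVar x y) d σ σ' → σ'.var (tmp (d + 1)) = s.var x →
      Keeps N s d σ (σ'.setVar (2 * x) (σ'.var (tmp (d + 1)))) := by
    intro y σ' h1 h2
    refine ⟨?_, fun e he => ?_⟩
    · have := h1.rep.setUser x (s.var x)
      rwa [show (s.setVar x y).setVar x (s.var x) = s by simp [State.setVar], ← h2] at this
    · rw [setVar_var_ne _ _ (by omega), h1.low e he]
  let I : ℕ → State → Prop := fun i σ' => (∃ y, Keeps N (s.setVar x y) d σ σ') ∧
    σ'.var (tmp (d + 1)) = s.var x ∧ σ'.var (tmp d) = g i ∧ σ'.var (tmp (d + 2)) = i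
  refine Runs.le (Runs.seq (.assign (Q := fun σ' => Keeps N s d σ σ' ∧
      σ'.var (tmp (d + 1)) = s.var x)
    ⟨(Keeps.refl hσ).setTmp (by omega) _, by simpa [Exp.eval] using hσ.var x⟩) fun σ1 h1 =>
    Runs.seq (.assign (Q := fun σ' => Keeps N s d σ σ' ∧ σ'.var (tmp (d + 1)) = s.var x ∧
      σ'.var (tmp d) = 0)
    ⟨h1.1.setTmp (by omega) _, by rw [setVar_var_ne _ _ (by simp), h1.2], by simp [Exp.eval]⟩)
      fun σ2 h2 =>
    Runs.seq (.assign (Q := I 0)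
    ⟨⟨s.var x, by
      rw [show s.setVar x (s.var x) = s by simp [State.setVar]]
      exact h2.1.setTmp (by omega) _⟩, by rw [setVar_var_ne _ _ (by simp), h2.2.1],
      by rw [setVar_var_ne _ _ (by simp), h2.2.2, hg0], by simp [Exp.eval]⟩)
      fun σ3 h3 =>
    Runs.seq (Runs.loop (N := N) (B := 2 + (T + (6 + 4))) I ?_ ?_ h3) fun σ4 h4 =>
      .assign (Q := fun σ' => Keeps N s d σ σ' ∧ σ'.var (tmp d) = g N) ?_) ?_
  · rintro i σ' ⟨⟨y, h1⟩, -, -, h4⟩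
    exact ⟨h1.rep.bound, h4⟩
  · rintro i hi σ' ⟨⟨y, h1⟩, h2, h3, h4⟩
    refine Runs.seq (R := fun σ'' => Keeps N (s.setVar x i) d σ σ'' ∧
      σ''.var (tmp (d + 1)) = s.var x ∧ σ''.var (tmp d) = g i ∧ σ''.var (tmp (d + 2)) = i)
      (Runs.assign ⟨⟨?_, fun e he => ?_⟩, ?_, ?_, ?_⟩) ?_
    · have := h1.rep.setUser x i
      rw [show (s.setVar x y).setVar x i = s.setVar x i by simp [State.setVar]] at this
      simpa [Exp.eval, h4] using this
    · rw [setVar_var_ne _ _ (by omega), h1.low e he]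
    · rw [setVar_var_ne _ _ (by simp only [tmp]; omega), h2]
    · rw [setVar_var_ne _ _ (by simp only [tmp]; omega), h3]
    · rw [setVar_var_ne _ _ (by simp only [tmp]; omega), h4]
    · rintro σ5 ⟨k1, k2, k3, k4⟩
      refine Runs.seq (hp i hi σ5 k1.rep) ?_
      rintro σ6 ⟨l1, l2⟩
      refine Runs.seq (R := fun σ'' => Keeps N (s.setVar x i) d σ σ'' ∧
        σ''.var (tmp (d + 1)) = s.var x ∧ σ''.var (tmp d) = g (i + 1) ∧ σ''.var (tmp (d + 2)) = i)
        ((Runs.assign ⟨(k1.trans (l1.mono (by omega))).setTmp le_rfl _, ?_, ?_, ?_⟩).mono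
          (by omega) fun _ h => h) ?_
      rotate_left
      · rw [setVar_var_ne _ _ (by simp), l1.low _ (by omega), k2]
      · rw [setVar_var_self, hupd, l2, l1.low _ (by omega), k3, hg]
      · rw [setVar_var_ne _ _ (by simp), l1.low _ (by omega), k4]
      · rintro σ7 ⟨m1, m2, m3, m4⟩
        refine Runs.assign ⟨⟨i, m1.setTmp (by omega) _⟩, ?_, ?_, ?_⟩
        · rw [setVar_var_ne _ _ (by simp), m2]
        · rw [setVar_var_ne _ _ (by simp), m3]
        · simp [Exp.eval, m4]
  · obtain ⟨⟨y, h5⟩, h6, h7, -⟩ := h4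
    exact ⟨key y σ4 h5 h6, by rw [setVar_var_ne _ _ (by simp only [tmp]; omega), h7]⟩
  · simp only [Exp.cost]
    rw [show 2 + (T + (6 + 4)) + 4 = T + 16 by omega]
    omega

/-- The compiled expression computes the value of the expression, within the time bound. -/
theorem BExp.computes (N : ℕ) (e : BExp) :
    ∀ (d : ℕ) (s : State), Computes N (e.compile d) d (e.cost.eval N) s (e.eval N s) := by
  induction e with
  | const c =>
    intro d s σ hσ
    exact Runs.le (Runs.assign ⟨(Keeps.refl hσ).setTmp le_rfl _, by simp [Exp.eval, BExp.eval]⟩)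
        (by simp [BExp.cost, Exp.cost])
  | var x =>
    intro d s σ hσ
    exact Runs.le (Runs.assign ⟨(Keeps.refl hσ).setTmp le_rfl _, by
      simp [Exp.eval, BExp.eval, hσ.var]⟩) (by simp [BExp.cost, Exp.cost])
  | get a i ih =>
    intro d s σ hσ
    refine Runs.le (Runs.seq (ih d s σ hσ) fun σ' h => Runs.assign ⟨h.1.setTmp le_rfl _, ?_⟩)
        (by simp [BExp.cost, Exp.cost])
    simp [Exp.eval, BExp.eval, h.2, h.1.rep.arr]
  | add e f ihe ihf =>
    intro d s σ hσ
    refine Runs.le (Runs.seq (ihe d s σ hσ) fun σ' h =>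
      Runs.seq (ihf (d + 1) s σ' h.1.rep) fun σ'' h' =>
      Runs.assign ⟨(h.1.trans (h'.1.mono (by omega))).setTmp le_rfl _, ?_⟩)
        (by simp [BExp.cost, Exp.cost]; omega)
    simp [Exp.eval, BExp.eval, h'.2, h'.1.low d (by omega), h.2]
  | sub e f ihe ihf =>
    intro d s σ hσ
    refine Runs.le (Runs.seq (ihe d s σ hσ) fun σ' h =>
      Runs.seq (ihf (d + 1) s σ' h.1.rep) fun σ'' h' =>
      Runs.assign ⟨(h.1.trans (h'.1.mono (by omega))).setTmp le_rfl _, ?_⟩)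
        (by simp [BExp.cost, Exp.cost]; omega)
    simp [Exp.eval, BExp.eval, h'.2, h'.1.low d (by omega), h.2]
  | idx e f ihe ihf =>
    intro d s σ hσ
    let I : ℕ → State → Prop := fun i σ' => Keeps N s d σ σ' ∧
      σ'.var (tmp d) = e.eval N s ∧ σ'.var (tmp (d + 1)) = i * e.eval N s + f.eval N s ∧
      σ'.var (tmp (d + 2)) = i
    refine Runs.le (Runs.seq (ihe d s σ hσ) fun σ' h =>
      Runs.seq (ihf (d + 1) s σ' h.1.rep) fun σ'' h' =>
      Runs.seq (Runs.assign (Q := I 0)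
        ⟨(h.1.trans (h'.1.mono (by omega))).setTmp (by omega) _, ?_, ?_, ?_⟩) fun σ3 h3 =>
      Runs.seq (Runs.loop (N := N) (B := 4 + 4) I ?_ ?_ h3) fun σ4 h4 =>
      Runs.assign ⟨h4.1.setTmp le_rfl _, ?_⟩) ?_
    · rw [setVar_var_ne _ _ (by simp), h'.1.low d (by omega), h.2]
    · rw [setVar_var_ne _ _ (by simp), h'.2]; simp
    · simp [Exp.eval]
    · rintro i σ' ⟨k1, -, -, k4⟩
      exact ⟨k1.rep.bound, k4⟩
    · rintro i - σ' ⟨k1, k2, k3, k4⟩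
      refine Runs.seq (Runs.assign (Q := fun σ' => Keeps N s d σ σ' ∧
        σ'.var (tmp d) = e.eval N s ∧ σ'.var (tmp (d + 1)) = (i + 1) * e.eval N s + f.eval N s ∧
        σ'.var (tmp (d + 2)) = i) ⟨k1.setTmp (by omega) _, ?_, ?_, ?_⟩) ?_
      · rw [setVar_var_ne _ _ (by simp), k2]
      · simp only [setVar_var_self, Exp.eval, k2, k3]; ring
      · rw [setVar_var_ne _ _ (by simp), k4]
      · rintro σ5 ⟨l1, l2, l3, l4⟩
        refine Runs.assign ⟨l1.setTmp (by omega) _, ?_, ?_, ?_⟩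
        · rw [setVar_var_ne _ _ (by simp), l2]
        · rw [setVar_var_ne _ _ (by simp), l3]
        · simp [Exp.eval, l4]
    · simp [Exp.eval, BExp.eval, h4.2.2.1]
    · simp [BExp.cost, Exp.cost]; omega
  | ite b e f ihb ihe ihf =>
    intro d s σ hσ
    refine Runs.le (Runs.seq (ihb d s σ hσ) fun σ' h => Runs.ite
      (fun hb => (ihe d s σ' h.1.rep).mono le_rfl fun σ'' h' => ⟨h.1.trans h'.1, ?_⟩)
      fun hb => (ihf d s σ' h.1.rep).mono le_rfl fun σ'' h' => ⟨h.1.trans h'.1, ?_⟩)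
        (by simp [BExp.cost, Exp.cost]; omega)
    · rw [h'.2, BExp.eval, if_pos]
      simpa [Exp.eval, h.2] using hb
    · rw [h'.2, BExp.eval, if_neg]
      simpa [Exp.eval, h.2] using hb
  | sum x e ih =>
    intro d s
    have := Computes.foldProg (d := d) (fun i _ => ih (d + 3) (s.setVar x i)) (N := N)
      (upd := .add (.var (tmp d)) (.var (tmp (d + 3)))) (fun a b => a + b) (fun σ => rfl)
      (by simp [Exp.cost]) (fun i => ∑ j ∈ Finset.range i, e.eval N (s.setVar x j)) (by simp)
      fun i => Finset.sum_range_succ _ _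
    simpa [BExp.cost, BExp.eval, BExp.compile] using this
  | sup x e ih =>
    intro d s
    have := Computes.foldProg (d := d) (fun i _ => ih (d + 3) (s.setVar x i)) (N := N)
      (upd := .add (.var (tmp d)) (.sub (.var (tmp (d + 3))) (.var (tmp d))))
      (fun a b => a + (b - a)) (fun σ => rfl) (by simp [Exp.cost])
      (fun i => (Finset.range i).sup fun j => e.eval N (s.setVar x j)) (by simp)
      fun i => by
        rw [Finset.range_add_one, Finset.sup_insert, Nat.max_def]
        split <;> omega
    simpa [BExp.cost, BExp.eval, BExp.compile] using this

/-- The program of a command; it uses only the intermediate results from level `d` on. -/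
def Cmd.compile : ℕ → Cmd → Prog
  | d, put a i e => .seq (i.compile d) <| .seq (e.compile (d + 1)) <|
      .put a (.var (tmp d)) (.var (tmp (d + 1)))
  | d, seq c c' => .seq (c.compile d) (c'.compile d)
  | d, forN x c => .seq (.assign (tmp d) (.const 0)) <|
      .loop (.sub (.var 1) (.var (tmp d))) <| .seq (.assign (2 * x) (.var (tmp d))) <|
        .seq (c.compile (d + 1)) <| .assign (tmp d) (.add (.var (tmp d)) (.const 1))

/-- A bound for the running time of the compiled command, as a polynomial in `N`. -/
noncomputable def Cmd.cost : Cmd → Polynomial ℕ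
  | put _ i e => i.cost + e.cost + 3
  | seq c c' => c.cost + c'.cost
  | forN _ c => Polynomial.X * (c.cost + 10) + 6

/-- The compiled command has the effect of the command, within the time bound. -/
theorem Cmd.runs_compile (N : ℕ) (c : Cmd) : ∀ (d : ℕ) (s σ : State), Rep N s σ →
    Runs (c.compile d) σ (c.cost.eval N) (Keeps N (c.run N s) d σ) := by
  induction c with
  | put a i e =>
    intro d s σ hσ
    refine Runs.le (Runs.seq (i.computes N d s σ hσ) fun σ' h =>
      Runs.seq (e.computes N (d + 1) s σ' h.1.rep) fun σ'' h' => Runs.put ?_)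
        (by simp [Cmd.cost, Exp.cost]; omega)
    have h'' := h.1.trans (h'.1.mono (Nat.le_succ d))
    refine ⟨⟨fun x => h''.rep.var x, ?_, h''.rep.bound⟩, fun e he => h''.low e he⟩
    simp [State.setArr, Cmd.run, Exp.eval, h'.2, h'.1.low d (by omega), h.2, h''.rep.arr]
  | seq c c' ih ih' =>
    intro d s σ hσ
    refine Runs.le (Runs.seq (ih d s σ hσ) fun σ' h =>
      (ih' d _ σ' h.rep).mono le_rfl fun σ'' h' => ⟨h'.rep, fun e he => ?_⟩) (by simp [Cmd.cost])
    rw [h'.low e he, h.low e he]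
  | forN x c ih =>
    intro d s σ hσ
    let J : ℕ → State := fun i => iter (fun i s => c.run N (s.setVar x i)) i s
    let I : ℕ → State → Prop := fun i σ' => Keeps N (J i) d σ σ' ∧ σ'.var (tmp d) = i
    refine Runs.mono (Runs.seq (Runs.assign (Q := I 0) ⟨(Keeps.refl hσ).setTmp le_rfl _, ?_⟩)
      fun σ' h => (Runs.loop (N := N) (B := 2 + (c.cost.eval N + 4)) I ?_ ?_ h)) ?_
      fun σ' h => h.1
    · simp [Exp.eval]
    · rintro i σ' ⟨h1, h2⟩
      exact ⟨h1.rep.bound, h2⟩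
    · rintro i - σ' ⟨h1, h2⟩
      refine Runs.seq (R := fun σ'' => Keeps N ((J i).setVar x i) d σ σ'' ∧ σ''.var (tmp d) = i)
        (Runs.assign ⟨⟨?_, fun e he => ?_⟩, ?_⟩) fun σ1 k => Runs.seq
        ((ih (d + 1) _ σ1 k.1.rep).mono le_rfl fun σ2 l =>
          show Keeps N (J (i + 1)) d σ σ2 ∧ σ2.var (tmp d) = i from
          ⟨⟨l.rep, fun e he => ?_⟩, ?_⟩) fun σ3 m =>
        Runs.assign ⟨m.1.setTmp le_rfl _, ?_⟩
      · simpa [Exp.eval, h2] using h1.rep.setUser x i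
      · rw [setVar_var_ne _ _ (by omega), h1.low e he]
      · rw [setVar_var_ne _ _ (by simp only [tmp]; omega), h2]
      · rw [l.low e (by omega), k.1.low e he]
      · rw [l.low d (by omega), k.2]
      · simp [Exp.eval, m.2]
    · simp only [Cmd.cost, Exp.cost, Polynomial.eval_add, Polynomial.eval_mul, Polynomial.eval_X,
        Polynomial.eval_ofNat]
      rw [show 2 + (c.cost.eval N + 4) + 4 = c.cost.eval N + 10 by omega]
      omega

end RAM

/-! ### Consecutive orderings from forcing classes -/

namespace Consecutive

open Relation

variable {V : Type*}

/-- In every ordering of `K` for which the members of `K` that contain a given `v` are consecutive,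
the pair `x` of members of `K` has the same orientation as the pair `y`: the two pairs agree in one
coordinate, and some `v` that misses the common coordinate belongs to both other coordinates. -/
def Force (K : Set ℕ) (S : ℕ → Set V) (x y : ℕ × ℕ) : Prop :=
  (x.1 ∈ K ∧ x.2 ∈ K ∧ y.1 ∈ K ∧ y.2 ∈ K) ∧
    ((x.1 = y.1 ∧ ∃ v, v ∉ S x.1 ∧ v ∈ S x.2 ∧ v ∈ S y.2) ∨
      (x.2 = y.2 ∧ ∃ v, v ∉ S x.2 ∧ v ∈ S x.1 ∧ v ∈ S y.1))

/-- Two pairs lie in the same forcing class. -/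
abbrev Reach (K : Set ℕ) (S : ℕ → Set V) : ℕ × ℕ → ℕ × ℕ → Prop := ReflTransGen (Force K S)

/-- `pos` orders `K` in such a way that the members of `K` containing a given `v` are
consecutive. -/
structure IsConsecutive (K : Set ℕ) (S : ℕ → Set V) (pos : ℕ → ℝ) : Prop where
  inj : ∀ a ∈ K, ∀ b ∈ K, pos a = pos b → a = b
  conv : ∀ a ∈ K, ∀ b ∈ K, ∀ c ∈ K, pos a < pos b → pos b < pos c → S a ∩ S c ⊆ S b

/-- `f` labels every pair with the largest code `N * p + q` of a pair `(p, q)` in its forcing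
class. -/
structure IsLabel (K : Set ℕ) (S : ℕ → Set V) (N : ℕ) (f : ℕ × ℕ → ℕ) : Prop where
  const : ∀ x y, Force K S x y → f x = f y
  le : ∀ x : ℕ × ℕ, x.1 ∈ K → x.2 ∈ K → N * x.1 + x.2 ≤ f x
  attained : ∀ x : ℕ × ℕ, x.1 ∈ K → x.2 ∈ K → ∃ y, Reach K S x y ∧ f x = N * y.1 + y.2

variable {K : Set ℕ} {S : ℕ → Set V} {pos : ℕ → ℝ} {N : ℕ} {f : ℕ × ℕ → ℕ}

theorem Force.symm {x y : ℕ × ℕ} (h : Force K S x y) : Force K S y x := by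
  obtain ⟨⟨h1, h2, h3, h4⟩, ⟨h, v, hv⟩ | ⟨h, v, hv⟩⟩ := h
  · exact ⟨⟨h3, h4, h1, h2⟩, .inl ⟨h.symm, v, h ▸ hv.1, hv.2.2, hv.2.1⟩⟩
  · exact ⟨⟨h3, h4, h1, h2⟩, .inr ⟨h.symm, v, h ▸ hv.1, hv.2.2, hv.2.1⟩⟩

theorem Force.swap {x y : ℕ × ℕ} (h : Force K S x y) : Force K S x.swap y.swap := by
  obtain ⟨⟨h1, h2, h3, h4⟩, h | h⟩ := h
  · exact ⟨⟨h2, h1, h4, h3⟩, .inr h⟩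
  · exact ⟨⟨h2, h1, h4, h3⟩, .inl h⟩

theorem Force.of_snd {p q q' : ℕ} (hp : p ∈ K) (hq : q ∈ K) (hq' : q' ∈ K) {v : V}
    (h1 : v ∉ S p) (h2 : v ∈ S q) (h3 : v ∈ S q') : Force K S (p, q) (p, q') :=
  ⟨⟨hp, hq, hp, hq'⟩, .inl ⟨rfl, v, h1, h2, h3⟩⟩

theorem Force.of_fst {p p' q : ℕ} (hp : p ∈ K) (hp' : p' ∈ K) (hq : q ∈ K) {v : V}
    (h1 : v ∉ S q) (h2 : v ∈ S p) (h3 : v ∈ S p') : Force K S (p, q) (p', q) :=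
  ⟨⟨hp, hq, hp', hq⟩, .inr ⟨rfl, v, h1, h2, h3⟩⟩

theorem Reach.symm {x y : ℕ × ℕ} (h : Reach K S x y) : Reach K S y x := by
  induction h with
  | refl => exact .refl
  | tail _ h ih => exact .head h.symm ih

theorem Reach.swap {x y : ℕ × ℕ} (h : Reach K S x y) : Reach K S x.swap y.swap := by
  induction h with
  | refl => exact .refl
  | tail _ h ih => exact ih.tail h.swap

theorem IsConsecutive.neg (h : IsConsecutive K S pos) : IsConsecutive K S fun c => -pos c :=
  ⟨fun a ha b hb hab => h.inj a ha b hb (neg_injective hab), fun a ha b hb c hc h1 h2 _ hv =>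
    h.conv c hc b hb a ha (neg_lt_neg_iff.1 h2) (neg_lt_neg_iff.1 h1) ⟨hv.2, hv.1⟩⟩

/-- Members of `K` that are not separated by `v ∉ S b` lie on the same side of `b`. -/
theorem IsConsecutive.lt_of_lt (h : IsConsecutive K S pos) {b z z' : ℕ} (hb : b ∈ K) (hz : z ∈ K)
    (hz' : z' ∈ K) {v : V} (hvb : v ∉ S b) (hvz : v ∈ S z) (hvz' : v ∈ S z') (hlt : pos b < pos z) :
    pos b < pos z' := by
  by_contra hn
  rcases (not_lt.1 hn).lt_or_eq with h1 | h1
  · exact hvb (h.conv z' hz' b hb z hz h1 hlt ⟨hvz', hvz⟩)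
  · exact hvb (h.inj _ hz' _ hb h1 ▸ hvz')

theorem IsConsecutive.lt_of_lt' (h : IsConsecutive K S pos) {b z z' : ℕ} (hb : b ∈ K) (hz : z ∈ K)
    (hz' : z' ∈ K) {v : V} (hvb : v ∉ S b) (hvz : v ∈ S z) (hvz' : v ∈ S z') (hlt : pos z < pos b) :
    pos z' < pos b :=
  neg_lt_neg_iff.1 (h.neg.lt_of_lt hb hz hz' hvb hvz hvz' (neg_lt_neg hlt))

theorem Reach.mem {x y : ℕ × ℕ} (h : Reach K S x y) (h1 : x.1 ∈ K) (h2 : x.2 ∈ K) :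
    y.1 ∈ K ∧ y.2 ∈ K := by
  induction h with
  | refl => exact ⟨h1, h2⟩
  | tail _ h _ => exact ⟨h.1.2.2.1, h.1.2.2.2⟩

theorem IsConsecutive.reach_lt (h : IsConsecutive K S pos) {x y : ℕ × ℕ} (hxy : Reach K S x y)
    (hx : pos x.1 < pos x.2) : pos y.1 < pos y.2 := by
  induction hxy with
  | refl => exact hx
  | @tail y z _ hyz ih =>
    obtain ⟨⟨h1, h2, h3, h4⟩, ⟨e, v, hv⟩ | ⟨e, v, hv⟩⟩ := hyz
    · rw [← e]
      exact h.lt_of_lt h1 h2 h4 hv.1 hv.2.1 hv.2.2 ih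
    · rw [← e]
      exact h.lt_of_lt' h2 h1 h3 hv.1 hv.2.1 hv.2.2 ih

/-- If the class of the outer pair `(a, c)` differs from those of `(a, b)` and `(b, c)`, then all of
its pairs have `b` between them, and `b` relates to them as to `a` and `c`. -/
theorem IsConsecutive.reach_outer (h : IsConsecutive K S pos) {a b c : ℕ} (hb : b ∈ K)
    (hab : pos a < pos b) (hbc : pos b < pos c) (h1 : ¬Reach K S (a, b) (a, c))
    (h2 : ¬Reach K S (b, c) (a, c)) {y : ℕ × ℕ} (hy : Reach K S (a, c) y) :
    pos y.1 < pos b ∧ pos b < pos y.2 ∧ Reach K S (a, b) (y.1, b) ∧ Reach K S (b, c) (b, y.2) := by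
  induction hy with
  | refl => exact ⟨hab, hbc, .refl, .refl⟩
  | @tail y z hy hyz ih =>
    obtain ⟨i1, i2, i3, i4⟩ := ih
    obtain ⟨y1, y2⟩ := y
    obtain ⟨z1, z2⟩ := z
    obtain ⟨⟨m1, m2, m3, m4⟩, ⟨e, v, hv⟩ | ⟨e, v, hv⟩⟩ := hyz
    · dsimp only at *
      subst e
      have hvb : v ∉ S b := fun hvb =>
        h1 ((i3.tail (Force.of_snd m1 hb m2 hv.1 hvb hv.2.1)).trans (Reach.symm hy))
      exact ⟨i1, h.lt_of_lt hb m2 m4 hvb hv.2.1 hv.2.2 i2, i3,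
        i4.tail (Force.of_snd hb m2 m4 hvb hv.2.1 hv.2.2)⟩
    · dsimp only at *
      subst e
      have hvb : v ∉ S b := fun hvb =>
        h2 ((i4.tail (Force.of_fst hb m1 m2 hv.1 hvb hv.2.1)).trans (Reach.symm hy))
      exact ⟨h.lt_of_lt' hb m1 m3 hvb hv.2.1 hv.2.2 i1, i2,
        i3.tail (Force.of_fst m1 m3 hb hvb hv.2.1 hv.2.2), i4⟩

/-- If the class of `(a, b)` differs from that of `(a, c)`, then all of its pairs lie before `c`,
and `c` relates to them as to `a` and `b`. -/
theorem IsConsecutive.reach_left (h : IsConsecutive K S pos) {a b c : ℕ} (hc : c ∈ K)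
    (hab : pos a < pos b) (hbc : pos b < pos c) (h1 : ¬Reach K S (a, b) (a, c)) {y : ℕ × ℕ}
    (hy : Reach K S (a, b) y) :
    pos y.1 < pos y.2 ∧ pos y.2 < pos c ∧ Reach K S (a, c) (y.1, c) ∧
      Reach K S (b, c) (y.2, c) := by
  induction hy with
  | refl => exact ⟨hab, hbc, .refl, .refl⟩
  | @tail y z hy hyz ih =>
    have hlt := h.reach_lt (hy.tail hyz) hab
    obtain ⟨i1, i2, i3, i4⟩ := ih
    obtain ⟨y1, y2⟩ := y
    obtain ⟨z1, z2⟩ := z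
    obtain ⟨⟨m1, m2, m3, m4⟩, ⟨e, v, hv⟩ | ⟨e, v, hv⟩⟩ := hyz
    · dsimp only at *
      subst e
      have hvc : v ∉ S c := fun hvc =>
        h1 ((hy.tail (Force.of_snd m1 m2 hc hv.1 hv.2.1 hvc)).trans i3.symm)
      exact ⟨hlt, h.lt_of_lt' hc m2 m4 hvc hv.2.1 hv.2.2 i2, i3,
        i4.tail (Force.of_fst m2 m4 hc hvc hv.2.1 hv.2.2)⟩
    · dsimp only at *
      subst e
      have hvc : v ∉ S c := fun hvc => hv.1 (h.conv _ m1 _ m2 _ hc i1 i2 ⟨hv.2.1, hvc⟩)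
      exact ⟨hlt, i2, i3.tail (Force.of_fst m1 m3 hc hvc hv.2.1 hv.2.2), i4⟩

/-- The mirror image of `IsConsecutive.reach_left`. -/
theorem IsConsecutive.reach_right (h : IsConsecutive K S pos) {a b c : ℕ} (ha : a ∈ K)
    (hab : pos a < pos b) (hbc : pos b < pos c) (h1 : ¬Reach K S (b, c) (a, c)) {y : ℕ × ℕ}
    (hy : Reach K S (b, c) y) : Reach K S (a, b) (a, y.1) ∧ Reach K S (a, c) (a, y.2) := by
  obtain ⟨-, -, i3, i4⟩ := h.neg.reach_left (a := c) (b := b) ha (neg_lt_neg hbc) (neg_lt_neg hab)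
    (fun h => h1 h.swap) hy.swap
  exact ⟨i4.swap, i3.swap⟩

/-- The ordering of `K` given by the labels: every forcing class is oriented like the pair with the
largest code in this class and its reverse. -/
def Prec (f : ℕ × ℕ → ℕ) (a b : ℕ) : Prop := f (b, a) < f (a, b)

theorem IsLabel.reach (hf : IsLabel K S N f) {x y : ℕ × ℕ} (h : Reach K S x y) : f x = f y := by
  induction h with
  | refl => rfl
  | tail _ h ih => exact ih.trans (hf.const _ _ h)

theorem IsLabel.prec_congr (hf : IsLabel K S N f) {a b c d : ℕ} (h : Reach K S (a, b) (c, d)) :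
    Prec f a b ↔ Prec f c d := by
  rw [Prec, Prec, hf.reach h, hf.reach (x := (b, a)) h.swap]
  rfl

/-- If `a` precedes `b`, then some first coordinate in the class of `(a, b)` is at least as large
as all second coordinates. -/
theorem IsLabel.exists_max (hf : IsLabel K S N f) (hK : ∀ a ∈ K, a < N) {a b : ℕ} (ha : a ∈ K)
    (hb : b ∈ K) (hab : Prec f a b) :
    ∃ α β, Reach K S (a, b) (α, β) ∧ ∀ x y, Reach K S (a, b) (x, y) → y ≤ α := by
  obtain ⟨⟨α, β⟩, h1, h2⟩ := hf.attained (a, b) ha hb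
  refine ⟨α, β, h1, fun x y hxy => ?_⟩
  have h3 := hf.reach (x := (b, a)) (y := (y, x)) hxy.swap
  have h4 := hxy.mem ha hb
  have h5 := hf.le (y, x) h4.2 h4.1
  have h6 := hK _ (h1.mem ha hb).2
  have h7 : N * y + x < N * α + β := by
    rw [← h2]; exact h5.trans_lt (h3 ▸ hab)
  by_contra hlt
  have h8 : N * (α + 1) ≤ N * y := Nat.mul_le_mul_left _ (by omega)
  rw [mul_add] at h8
  dsimp only at h6
  omega

/-- The relation `Prec` has no cycle of length three whose members are in consecutive
position. -/
theorem IsLabel.not_cycle_of_lt (hf : IsLabel K S N f) (h : IsConsecutive K S pos)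
    (hK : ∀ a ∈ K, a < N) {a b c : ℕ} (ha : a ∈ K) (hb : b ∈ K) (hc : c ∈ K)
    (hab : pos a < pos b) (hbc : pos b < pos c) (h1 : Prec f a b) (h2 : Prec f b c)
    (h3 : Prec f c a) : False := by
  have n1 : ¬Reach K S (a, b) (a, c) := fun hr => lt_asymm h3 ((hf.prec_congr hr).1 h1)
  have n2 : ¬Reach K S (b, c) (a, c) := fun hr => lt_asymm h3 ((hf.prec_congr hr).1 h2)
  -- The coordinates of the three classes form three disjoint sets `X`, `Y`, `Z`; each of them
  -- would contain a number at least as large as all members of the next one.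
  obtain ⟨α, α', hα, hα'⟩ := hf.exists_max hK ha hb h1
  obtain ⟨β, β', hβ, hβ'⟩ := hf.exists_max hK hb hc h2
  obtain ⟨γ, γ', hγ, hγ'⟩ := hf.exists_max hK hc ha h3
  have l := h.reach_left hc hab hbc n1 hα
  have r := h.reach_right ha hab hbc n2 hβ
  have o := h.reach_outer hb hab hbc n1 n2 hγ.swap
  have e1 : α ≤ γ := hγ' _ _ (Reach.swap l.2.2.1)
  have e2 : γ ≤ β := hβ' _ _ o.2.2.2
  have e3 : β ≤ α := hα' _ _ r.1
  obtain rfl : α = β := by omega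
  have l' := h.reach_left hc hab hbc n1 r.1
  exact n2 (l'.2.2.2.trans (Reach.symm l.2.2.1))

theorem IsLabel.prec_total (hf : IsLabel K S N f) (h : IsConsecutive K S pos)
    (hK : ∀ a ∈ K, a < N) {a b : ℕ} (ha : a ∈ K) (hb : b ∈ K) (hab : a ≠ b) :
    Prec f a b ∨ Prec f b a := by
  by_contra hn
  rw [not_or, Prec, Prec, not_lt, not_lt] at hn
  obtain ⟨⟨p, q⟩, h1, h2⟩ := hf.attained (a, b) ha hb
  obtain ⟨⟨p', q'⟩, h3, h4⟩ := hf.attained (b, a) hb ha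
  have k1 := h1.mem ha hb
  have k2 := h3.mem hb ha
  have e : N * p + q = N * p' + q' := by rw [← h2, ← h4]; exact le_antisymm hn.1 hn.2
  have hq := hK _ k1.2
  have hq' := hK _ k2.2
  dsimp only at hq hq'
  have hp : p = p' := by
    have := congrArg (· / N) e
    simpa [Nat.mul_add_div (show N > 0 by omega), Nat.div_eq_of_lt hq, Nat.div_eq_of_lt hq']
      using this
  subst hp
  obtain rfl : q = q' := by omega
  have hr : Reach K S (a, b) (b, a) := h1.trans h3.symm
  rcases lt_or_gt_of_ne (fun e => hab (h.inj a ha b hb e)) with hlt | hlt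
  · exact lt_asymm hlt (h.reach_lt hr hlt)
  · exact lt_asymm hlt (h.reach_lt hr.symm hlt)

theorem Prec.ne {a b : ℕ} (h : Prec f a b) : a ≠ b := by
  rintro rfl
  exact lt_irrefl _ h

/-- `Prec` is transitive although it need not agree with `pos` or with its reverse: a forcing class
may be oriented independently of the others. The cases of a cycle are reduced to
`IsLabel.not_cycle_of_lt` by rotation and reflection. -/
theorem IsLabel.prec_trans (hf : IsLabel K S N f) (h : IsConsecutive K S pos)
    (hK : ∀ a ∈ K, a < N) {a b c : ℕ} (ha : a ∈ K) (hb : b ∈ K) (hc : c ∈ K)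
    (h1 : Prec f a b) (h2 : Prec f b c) : Prec f a c := by
  have hac : a ≠ c := by
    rintro rfl
    exact lt_asymm h1 h2
  refine (hf.prec_total h hK ha hc hac).resolve_right fun h3 => ?_
  have i1 : pos a ≠ pos b := fun e => h1.ne (h.inj a ha b hb e)
  have i2 : pos b ≠ pos c := fun e => h2.ne (h.inj b hb c hc e)
  have i3 : pos a ≠ pos c := fun e => hac (h.inj a ha c hc e)
  rcases lt_or_gt_of_ne i1 with j1 | j1 <;> rcases lt_or_gt_of_ne i2 with j2 | j2 <;>
    rcases lt_or_gt_of_ne i3 with j3 | j3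
  · exact hf.not_cycle_of_lt h hK ha hb hc j1 j2 h1 h2 h3
  · exact lt_asymm (j1.trans j2) j3
  · exact hf.not_cycle_of_lt h.neg hK hb hc ha (neg_lt_neg j2) (neg_lt_neg j3) h2 h3 h1
  · exact hf.not_cycle_of_lt h hK hc ha hb j3 j1 h3 h1 h2
  · exact hf.not_cycle_of_lt h.neg hK hc ha hb (neg_lt_neg j3) (neg_lt_neg j1) h3 h1 h2
  · exact hf.not_cycle_of_lt h hK hb hc ha j2 j3 h2 h3 h1
  · exact lt_asymm (j2.trans j1) j3
  · exact hf.not_cycle_of_lt h.neg hK ha hb hc (neg_lt_neg j1) (neg_lt_neg j2) h1 h2 h3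

theorem IsLabel.prec_conv (hf : IsLabel K S N f) {a b c : ℕ} (ha : a ∈ K) (hb : b ∈ K)
    (hc : c ∈ K) (h1 : Prec f a b) (h2 : Prec f b c) : S a ∩ S c ⊆ S b := by
  rintro v ⟨hva, hvc⟩
  by_contra hvb
  have : Force K S (a, b) (c, b) := (Force.of_fst ha hc hb hvb hva hvc)
  exact lt_asymm ((hf.prec_congr (.single this)).1 h1) h2

/-- Rounds of propagation along forcing steps produce the labels: the sum of the labels grows in
each round until they are stable, so `N ^ 4` rounds suffice. -/
theorem isLabel_of_rounds (hN : 0 < N) (hK : ∀ a ∈ K, a < N) (g : ℕ → ℕ × ℕ → ℕ)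
    (h0 : ∀ x, g 0 x = N * x.1 + x.2)
    (hle : ∀ t x, g t x ≤ g (t + 1) x)
    (hforce : ∀ t x y, Force K S x y → g t y ≤ g (t + 1) x)
    (hattained : ∀ t x, g (t + 1) x = g t x ∨ ∃ y, Force K S x y ∧ g (t + 1) x = g t y)
    (hdet : ∀ t, (∀ x : ℕ × ℕ, x.1 < N → x.2 < N → g (t + 1) x = g t x) →
      ∀ x : ℕ × ℕ, x.1 < N → x.2 < N → g (t + 2) x = g (t + 1) x) :
    IsLabel K S N (g (N ^ 4)) := by
  have hatt : ∀ t x, ∃ y, Reach K S x y ∧ g t x = N * y.1 + y.2 := by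
    intro t
    induction t with
    | zero => exact fun x => ⟨x, .refl, h0 x⟩
    | succ t ih =>
      intro x
      rcases hattained t x with h | ⟨y, h1, h2⟩
      · rw [h]; exact ih x
      · obtain ⟨z, h3, h4⟩ := ih y
        exact ⟨z, .head h1 h3, h2.trans h4⟩
  have hbound : ∀ t (x : ℕ × ℕ), x.1 < N → x.2 < N → g t x < N * N := by
    intro t x h1 h2
    obtain ⟨y, h3, h4⟩ := hatt t x
    have : y.1 < N ∧ y.2 < N := by
      rcases ReflTransGen.cases_tail h3 with rfl | ⟨z, -, hz⟩
      · exact ⟨h1, h2⟩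
      · exact ⟨hK _ hz.1.2.2.1, hK _ hz.1.2.2.2⟩
    have h5 : N * (y.1 + 1) ≤ N * N := Nat.mul_le_mul_left _ (by omega)
    rw [mul_add] at h5
    omega
  let s : ℕ → ℕ := fun t => ∑ x ∈ Finset.range N ×ˢ Finset.range N, g t x
  have hstab : ∃ t < N ^ 4, ∀ x : ℕ × ℕ, x.1 < N → x.2 < N → g (t + 1) x = g t x := by
    by_contra! hno
    have hs : ∀ t ≤ N ^ 4, t ≤ s t := by
      intro t
      induction t with
      | zero => simp
      | succ t ih =>
        intro ht
        obtain ⟨x, h1, h2, h3⟩ := hno t (by omega)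
        have : s t < s (t + 1) := Finset.sum_lt_sum (fun x _ => hle t x)
          ⟨x, by simp [h1, h2], lt_of_le_of_ne (hle t x) h3.symm⟩
        have := ih (by omega)
        omega
    have h1 := hs _ le_rfl
    have h2 : s (N ^ 4) < ∑ x ∈ Finset.range N ×ˢ Finset.range N, N * N := by
      refine Finset.sum_lt_sum_of_nonempty ⟨(0, 0), by simp [hN]⟩ fun x hx => ?_
      simp only [Finset.mem_product, Finset.mem_range] at hx
      exact hbound _ x hx.1 hx.2
    simp only [Finset.sum_const, Finset.card_product, Finset.card_range, smul_eq_mul] at h2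
    have h3 : N * N * (N * N) = N ^ 4 := by ring
    omega
  obtain ⟨t, ht, hst⟩ := hstab
  have hst' : ∀ r, ∀ x : ℕ × ℕ, x.1 < N → x.2 < N → g (t + r + 1) x = g (t + r) x := by
    intro r
    induction r with
    | zero => exact hst
    | succ r ih => exact hdet _ ih
  have hfix := hst' (N ^ 4 - t)
  rw [show t + (N ^ 4 - t) = N ^ 4 by omega] at hfix
  have hmono : ∀ t x, g 0 x ≤ g t x := fun t x => by
    induction t with
    | zero => exact le_rfl
    | succ t ih => exact ih.trans (hle t x)
  have hF : ∀ x y, Force K S x y → g (N ^ 4) y ≤ g (N ^ 4) x := fun x y h => by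
    rw [← hfix x (hK _ h.1.1) (hK _ h.1.2.1)]
    exact hforce _ _ _ h
  exact ⟨fun x y h => le_antisymm (hF _ _ h.symm) (hF _ _ h), fun x _ _ => h0 x ▸ hmono _ x,
    fun x _ _ => hatt _ x⟩

end Consecutive

/-! ### Connected pairs and the recursion for their number -/

namespace Election

open Relation

section Connected

variable {V C : Type*} [Fintype C] {E : Election V C} {W W' : Finset C} {u v w : V}

theorem Linked.symm (h : E.Linked W u v) : E.Linked W v u := by
  obtain ⟨c, h1, h2, h3⟩ := h
  exact ⟨c, h1, h3, h2⟩

theorem Connected.symm (h : E.Connected W u v) : E.Connected W v u := by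
  induction h with
  | refl => exact .refl
  | tail _ h ih => exact .head h.symm ih

theorem Connected.mono (hW : W ⊆ W') (h : E.Connected W u v) : E.Connected W' u v :=
  ReflTransGen.mono (fun _ _ ⟨c, h1, h2⟩ => ⟨c, hW h1, h2⟩) _ _ h

/-- A voter connected to another voter approves a member of the committee. -/
theorem Connected.eq_or_exists (h : E.Connected W u v) : u = v ∨ ∃ c ∈ W, c ∈ E.A v := by
  rcases ReflTransGen.cases_tail h with h | ⟨w, -, c, h1, -, h3⟩
  · exact .inl h.symm
  · exact .inr ⟨c, h1, h3⟩

/-- The pairs of distinct voters connected by `W`. -/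
def pairs (E : Election V C) (W : Finset C) : Set (Sym2 V) :=
  {p : Sym2 V | ∃ u v : V, u ≠ v ∧ p = s(u, v) ∧ E.Connected W u v}

theorem mk_mem_pairs : s(u, v) ∈ E.pairs W ↔ u ≠ v ∧ E.Connected W u v := by
  constructor
  · rintro ⟨a, b, h1, h2, h3⟩
    rcases Sym2.eq_iff.1 h2 with ⟨rfl, rfl⟩ | ⟨rfl, rfl⟩
    · exact ⟨h1, h3⟩
    · exact ⟨h1.symm, h3.symm⟩
  · rintro ⟨h1, h2⟩
    exact ⟨u, v, h1, rfl, h2⟩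

/-- `U` is empty or a class of voters connected by `W`. -/
def IsClass (E : Election V C) (W : Finset C) (U : Finset V) : Prop :=
  ∀ u ∈ U, ∀ v, E.Connected W u v ↔ v ∈ U

theorem cons_empty : E.cons ∅ = 0 := by
  have : E.pairs ∅ = ∅ := by
    refine Set.eq_empty_iff_forall_notMem.2 fun p => ?_
    induction p with
    | _ u v =>
      rw [mk_mem_pairs]
      rintro ⟨h1, h2⟩
      rcases h2.eq_or_exists with h | ⟨c, h, -⟩
      · exact h1 h
      · simp at h
  change (E.pairs ∅).ncard = 0
  simp [this]

variable [Finite V]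

theorem cons_le_cons (h : ∀ u v, E.Linked W u v → E.Linked W' u v) : E.cons W ≤ E.cons W' := by
  refine Set.ncard_le_ncard ?_ (Set.toFinite _)
  rintro p ⟨u, v, h1, h2, h3⟩
  exact ⟨u, v, h1, h2, ReflTransGen.mono h _ _ h3⟩

theorem cons_mono (h : W ⊆ W') : E.cons W ≤ E.cons W' :=
  cons_le_cons fun _ _ ⟨c, h1, h2⟩ => ⟨c, h h1, h2⟩

end Connected

section Insert

variable {V C : Type*} [Fintype V] [Fintype C] [DecidableEq C]

/-- The set of voters that approve `c`. -/
def supp (E : Election V C) (c : C) : Finset V := Finset.univ.filter fun v => c ∈ E.A v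

theorem mem_supp {E : Election V C} {c : C} {v : V} : v ∈ E.supp c ↔ c ∈ E.A v := by simp [supp]

variable {E : Election V C} {W : Finset C} {c : C} {U : Finset V}

/-- `U` is either empty or a class of voters connected by `W` that meets the supporters of `c`, and
it contains all supporters of `c` that approve a member of `W`. -/
structure Attaches (E : Election V C) (W : Finset C) (c : C) (U : Finset V) : Prop where
  isClass : E.IsClass W U
  covers : ∀ d ∈ W, ∀ v ∈ E.supp c, v ∈ E.supp d → v ∈ U
  meets : U = ∅ ∨ ∃ x ∈ U, x ∈ E.supp c

theorem Attaches.eq_of_connected (h : Attaches E W c U) {u v : V} (hu : u ∈ E.supp c)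
    (hU : u ∉ U) (huv : E.Connected W u v) : u = v := by
  rcases huv.symm.eq_or_exists with e | ⟨d, h1, h2⟩
  · exact e.symm
  · exact absurd (h.covers d h1 u hu (mem_supp.2 h2)) hU

variable [DecidableEq V]

/-- The new connections are those within the union of `U` and the supporters of `c`. -/
theorem Attaches.connected_insert (h : Attaches E W c U) {u v : V} :
    E.Connected (insert c W) u v ↔ E.Connected W u v ∨ u ∈ U ∪ E.supp c ∧ v ∈ U ∪ E.supp c := by
  constructor
  · intro huv
    induction huv with
    | refl => exact .inl .refl
    | @tail v w _ hvw ih =>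
      obtain ⟨d, h1, h2, h3⟩ := hvw
      rcases Finset.mem_insert.1 h1 with rfl | h1
      · right
        refine ⟨?_, Finset.mem_union_right _ (mem_supp.2 h3)⟩
        rcases ih with ih | ih
        · by_cases hv : v ∈ U
          · exact Finset.mem_union_left _ ((h.isClass v hv u).1 ih.symm)
          · rw [← h.eq_of_connected (mem_supp.2 h2) hv ih.symm]
            exact Finset.mem_union_right _ (mem_supp.2 h2)
        · exact ih.1
      · have hvw : E.Linked W v w := ⟨d, h1, h2, h3⟩
        rcases ih with ih | ih
        · exact .inl (ih.tail hvw)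
        · refine .inr ⟨ih.1, Finset.mem_union_left _ ?_⟩
          have hv : v ∈ U := by
            rcases Finset.mem_union.1 ih.2 with hv | hv
            · exact hv
            · exact h.covers d h1 v hv (mem_supp.2 h2)
          exact (h.isClass v hv w).1 (.single hvw)
  · rintro (huv | ⟨hu, hv⟩)
    · exact huv.mono (Finset.subset_insert _ _)
    · have link : ∀ {u v}, u ∈ E.supp c → v ∈ E.supp c → E.Connected (insert c W) u v :=
        fun hu hv => .single ⟨c, Finset.mem_insert_self _ _, mem_supp.1 hu, mem_supp.1 hv⟩
      rcases h.meets with rfl | ⟨x, hx, hxc⟩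
      · simp only [Finset.empty_union] at hu hv
        exact link hu hv
      · have hub : ∀ u ∈ U ∪ E.supp c, E.Connected (insert c W) x u := by
          intro u hu
          rcases Finset.mem_union.1 hu with hu | hu
          · exact ((h.isClass x hx u).2 hu).mono (Finset.subset_insert _ _)
          · exact link hxc hu
        exact (hub u hu).symm.trans (hub v hv)

theorem Attaches.isClass_insert (h : Attaches E W c U) :
    E.IsClass (insert c W) (U ∪ E.supp c) := by
  intro u hu v
  rw [h.connected_insert]
  refine ⟨?_, fun hv => .inr ⟨hu, hv⟩⟩
  rintro (huv | huv)
  · by_cases hU : u ∈ U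
    · exact Finset.mem_union_left _ ((h.isClass u hU v).1 huv)
    · rwa [← h.eq_of_connected ((Finset.mem_union.1 hu).resolve_left hU) hU huv]
  · exact huv.2

/-- Adding `c` merges the class `U` with the supporters of `c`. -/
theorem Attaches.cons_insert (h : Attaches E W c U) :
    E.cons (insert c W) + U.card.choose 2 = E.cons W + (U ∪ E.supp c).card.choose 2 := by
  let P : Finset V → Finset (Sym2 V) := fun U => U.offDiag.image Sym2.mk.uncurry
  have hP : ∀ (U : Finset V) (u v : V), s(u, v) ∈ P U ↔ u ≠ v ∧ u ∈ U ∧ v ∈ U := by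
    intro U u v
    simp only [P, Finset.mem_image, Finset.mem_offDiag, Prod.exists, Function.uncurry_apply_pair]
    constructor
    · rintro ⟨a, b, ⟨h1, h2, h3⟩, e⟩
      rcases Sym2.eq_iff.1 e with ⟨rfl, rfl⟩ | ⟨rfl, rfl⟩
      · exact ⟨h3, h1, h2⟩
      · exact ⟨h3.symm, h2, h1⟩
    · rintro ⟨h1, h2, h3⟩
      exact ⟨u, v, ⟨h2, h3, h1⟩, rfl⟩
  have h1 : E.pairs (insert c W) = E.pairs W ∪ P (U ∪ E.supp c) := by
    ext p
    induction p with
    | _ u v =>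
      rw [Set.mem_union, mk_mem_pairs, mk_mem_pairs, Finset.mem_coe, hP, h.connected_insert]
      tauto
  have h2 : E.pairs W ∩ P (U ∪ E.supp c) = P U := by
    ext p
    induction p with
    | _ u v =>
      rw [Set.mem_inter_iff, mk_mem_pairs, Finset.mem_coe, Finset.mem_coe, hP, hP]
      constructor
      · rintro ⟨⟨h1, h2⟩, -, h3, h4⟩
        have hu : u ∈ U := by
          by_contra hU
          exact h1 (h.eq_of_connected ((Finset.mem_union.1 h3).resolve_left hU) hU h2)
        exact ⟨h1, hu, (h.isClass u hu v).1 h2⟩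
      · rintro ⟨h1, h2, h3⟩
        exact ⟨⟨h1, (h.isClass u h2 v).2 h3⟩, h1, Finset.mem_union_left _ h2,
          Finset.mem_union_left _ h3⟩
  have h3 := Set.ncard_union_add_ncard_inter (E.pairs W) (P (U ∪ E.supp c)) (Set.toFinite _)
    (Set.toFinite _)
  rw [← h1, h2, Set.ncard_coe_finset, Set.ncard_coe_finset, Sym2.card_image_offDiag,
    Sym2.card_image_offDiag] at h3
  exact h3

end Insert

/-! ### Undominated candidates of elections in the domain -/

section Kept

variable {V C : Type*} [Fintype V] [Fintype C] [LinearOrder C]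

/-- The candidates whose set of supporters is not contained in that of another candidate. Among
candidates with the same supporters, the first one is retained. -/
noncomputable def kept (E : Election V C) : Finset C := by
  classical
  exact Finset.univ.filter fun c =>
    ¬∃ d, E.supp c ⊆ E.supp d ∧ (E.supp d ⊆ E.supp c → d < c)

theorem mem_kept {E : Election V C} {c : C} :
    c ∈ E.kept ↔ ∀ d, E.supp c ⊆ E.supp d → E.supp d ⊆ E.supp c ∧ c ≤ d := by
  simp only [kept, Finset.mem_filter, Finset.mem_univ, true_and, not_exists, not_and,
    Classical.not_imp, not_lt]

theorem exists_mem_kept (E : Election V C) (c : C) : ∃ d ∈ E.kept, E.supp c ⊆ E.supp d := by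
  classical
  obtain ⟨d, h1, h2⟩ := Finset.exists_max_image (Finset.univ.filter fun d => E.supp c ⊆ E.supp d)
    (fun d => toLex ((E.supp d).card, OrderDual.toDual d)) ⟨c, by simp⟩
  simp only [Finset.mem_filter, Finset.mem_univ, true_and] at h1 h2
  refine ⟨d, mem_kept.2 fun e he => ?_, h1⟩
  have h3 := Prod.Lex.toLex_le_toLex.1 (h2 e (h1.trans he))
  have h4 := Finset.card_le_card he
  rcases h3 with h3 | ⟨h3, h5⟩
  · dsimp only at h3
    omega
  · exact ⟨(Finset.eq_of_subset_of_card_le he h3.le).ge, h5⟩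

/-- Every committee can be replaced by a committee of undominated candidates. -/
theorem exists_subset_kept (E : Election V C) (W : Finset C) :
    ∃ W' ⊆ E.kept, W'.card ≤ W.card ∧ E.cons W ≤ E.cons W' := by
  choose g hg hg' using E.exists_mem_kept
  refine ⟨W.image g, fun c hc => ?_, Finset.card_image_le, cons_le_cons ?_⟩
  · obtain ⟨d, -, rfl⟩ := Finset.mem_image.1 hc
    exact hg d
  · rintro u v ⟨c, h1, h2, h3⟩
    exact ⟨g c, Finset.mem_image_of_mem g h1, mem_supp.1 (hg' c (mem_supp.2 h2)),
      mem_supp.1 (hg' c (mem_supp.2 h3))⟩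

/-- In the voter-candidate interval domain the intervals of undominated candidates are not nested,
hence ordered in the same way by their left and their right endpoints. Every voter approves
consecutive members of this order. -/
theorem IsVCI.exists_pos {E : Election V C} (h : E.IsVCI) :
    ∃ pos : C → ℝ, (∀ a ∈ E.kept, ∀ b ∈ E.kept, pos a = pos b → a = b) ∧
      ∀ a ∈ E.kept, ∀ b ∈ E.kept, ∀ c ∈ E.kept, pos a < pos b → pos b < pos c →
        ∀ v, v ∈ E.supp a → v ∈ E.supp c → v ∈ E.supp b := by
  obtain ⟨xC, xV, rC, rV, hC, hV, hA⟩ := h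
  have hA' : ∀ v c, v ∈ E.supp c ↔ xV v - rV v ≤ xC c + rC c ∧ xC c - rC c ≤ xV v + rV v := by
    intro v c
    rw [mem_supp, hA, abs_le]
    constructor <;> rintro ⟨h1, h2⟩ <;> constructor <;> linarith
  have nested : ∀ a ∈ E.kept, ∀ b ∈ E.kept, xC b - rC b ≤ xC a - rC a →
      xC a + rC a ≤ xC b + rC b → a = b := by
    intro a ha b hb h1 h2
    have hab : E.supp a ⊆ E.supp b := fun v hv => by
      rw [hA'] at hv ⊢
      constructor <;> linarith [hv.1, hv.2]
    obtain ⟨h3, h4⟩ := mem_kept.1 ha b hab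
    exact le_antisymm h4 (mem_kept.1 hb a h3).2
  refine ⟨fun c => xC c - rC c, fun a ha b hb hab => ?_, fun a ha b hb c hc hab hbc v h1 h3 => ?_⟩
  · dsimp only at hab
    rcases le_total (xC a + rC a) (xC b + rC b) with h | h
    · exact nested a ha b hb hab.ge h
    · exact (nested b hb a ha hab.le h).symm
  · dsimp only at hab hbc
    have hr : xC a + rC a < xC b + rC b := by
      by_contra hr
      have := nested b hb a ha hab.le (not_lt.1 hr)
      subst this
      exact lt_irrefl _ hab
    rw [hA'] at h1 h3 ⊢
    constructor <;> linarith [h1.1, h3.2]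

/-- `r` is a linear order of the undominated candidates in which every voter approves consecutive
ones. -/
structure IsOrder (E : Election V C) (r : C → C → Prop) : Prop where
  ne : ∀ a b, r a b → a ≠ b
  trans : ∀ a ∈ E.kept, ∀ b ∈ E.kept, ∀ c ∈ E.kept, r a b → r b c → r a c
  total : ∀ a ∈ E.kept, ∀ b ∈ E.kept, a ≠ b → r a b ∨ r b a
  conv : ∀ a ∈ E.kept, ∀ b ∈ E.kept, ∀ c ∈ E.kept, r a b → r b c →
    ∀ v, v ∈ E.supp a → v ∈ E.supp c → v ∈ E.supp b

end Kept

section NatIndex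

variable {V : Type*} [Fintype V] {m : ℕ} (E : Election V (Fin m))

/-- The indices of the undominated candidates. -/
def keptIdx : Set ℕ := {c | ∃ h : c < m, (⟨c, h⟩ : Fin m) ∈ E.kept}

/-- The supporters of the candidate with a given index. -/
def suppIdx (c : ℕ) : Set V := {v | ∃ h : c < m, (⟨c, h⟩ : Fin m) ∈ E.A v}

variable {E}

/-- The labels of the forcing classes yield a suitable order of the undominated candidates. -/
theorem IsVCI.isOrder_of_isLabel (h : E.IsVCI) {N : ℕ} (hm : m ≤ N) {f : ℕ × ℕ → ℕ}
    (hf : Consecutive.IsLabel E.keptIdx E.suppIdx N f) :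
    E.IsOrder fun a b => Consecutive.Prec f a b := by
  obtain ⟨pos, hinj, hconv⟩ := h.exists_pos
  let pos' : ℕ → ℝ := fun c => if h : c < m then pos ⟨c, h⟩ else 0
  have hpos : ∀ c (h : c < m), pos' c = pos ⟨c, h⟩ := fun c h => dif_pos h
  have hc : Consecutive.IsConsecutive E.keptIdx E.suppIdx pos' := by
    refine ⟨?_, ?_⟩
    · rintro a ⟨ha, ha'⟩ b ⟨hb, hb'⟩ hab
      rw [hpos a ha, hpos b hb] at hab
      simpa using hinj _ ha' _ hb' hab
    · rintro a ⟨ha, ha'⟩ b ⟨hb, hb'⟩ c ⟨hc, hc'⟩ h1 h2 v ⟨⟨_, h3⟩, ⟨_, h4⟩⟩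
      rw [hpos a ha, hpos b hb] at h1
      rw [hpos c hc, hpos b hb] at h2
      exact ⟨hb, mem_supp.1 (hconv _ ha' _ hb' _ hc' h1 h2 v (mem_supp.2 h3) (mem_supp.2 h4))⟩
  have hK : ∀ a ∈ E.keptIdx, a < N := fun a ⟨ha, _⟩ => ha.trans_le hm
  have mem : ∀ a : Fin m, a ∈ E.kept → (a : ℕ) ∈ E.keptIdx := fun a ha => ⟨a.2, ha⟩
  refine ⟨fun a b hab => ?_, fun a ha b hb c hc' => ?_, fun a ha b hb hab => ?_,
    fun a ha b hb c hc' h1 h2 v h3 h4 => ?_⟩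
  · rintro rfl
    exact hab.ne rfl
  · exact hf.prec_trans hc hK (mem a ha) (mem b hb) (mem c hc')
  · exact hf.prec_total hc hK (mem a ha) (mem b hb) (Fin.val_ne_of_ne hab)
  · obtain ⟨_, h5⟩ := hf.prec_conv (mem a ha) (mem b hb) (mem c hc') h1 h2
      ⟨⟨a.2, mem_supp.1 h3⟩, ⟨c.2, mem_supp.1 h4⟩⟩
    exact mem_supp.2 h5

end NatIndex

/-! ### The dynamic program -/

section Best

variable {V C : Type*} [Fintype C] {E : Election V C}

/-- The largest number of pairs connected by at most `k` candidates from `S`. -/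
noncomputable def best (E : Election V C) (S : Finset C) (k : ℕ) : ℕ :=
  (S.powerset.filter fun W => W.card ≤ k).sup E.cons

theorem cons_le_best {S W : Finset C} {k : ℕ} (h : W ⊆ S) (hk : W.card ≤ k) :
    E.cons W ≤ E.best S k :=
  Finset.le_sup (f := E.cons) (by simp [h, hk])

theorem exists_cons_eq_best (E : Election V C) (S : Finset C) (k : ℕ) :
    ∃ W ⊆ S, W.card ≤ k ∧ E.cons W = E.best S k := by
  obtain ⟨W, h1, h2⟩ := Finset.exists_mem_eq_sup (S.powerset.filter fun W => W.card ≤ k)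
    ⟨∅, by simp⟩ E.cons
  simp only [Finset.mem_filter, Finset.mem_powerset] at h1
  exact ⟨W, h1.1, h1.2, h2.symm⟩

theorem best_mono {S T : Finset C} (k : ℕ) (h : S ⊆ T) : E.best S k ≤ E.best T k := by
  obtain ⟨W, h1, h2, h3⟩ := E.exists_cons_eq_best S k
  exact h3 ▸ cons_le_best (h1.trans h) h2

theorem best_zero (S : Finset C) : E.best S 0 = 0 := by
  obtain ⟨W, -, h2, h3⟩ := E.exists_cons_eq_best S 0
  rw [← h3, Finset.card_eq_zero.1 (Nat.le_zero.1 h2), cons_empty]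

end Best

section Dynamic

variable {V C : Type*} [Fintype V] [Fintype C] [LinearOrder C] {E : Election V C}
  {r : C → C → Prop}

/-- `c` is the last member of `W` with respect to `r`, and the supporters of `c` belong to the class
`U` of voters connected by `W`. -/
structure Ends (E : Election V C) (r : C → C → Prop) (W : Finset C) (c : C) (U : Finset V) :
    Prop where
  mem : c ∈ W
  last : ∀ d ∈ W, d ≠ c → r d c
  supp_subset : E.supp c ⊆ U
  isClass : E.IsClass W U

theorem IsOrder.exists_last (hr : E.IsOrder r) {W : Finset C} (hW : W ⊆ E.kept)
    (hne : W.Nonempty) : ∃ c ∈ W, ∀ d ∈ W, d ≠ c → r d c := by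
  induction hne using Finset.Nonempty.cons_induction with
  | singleton a => exact ⟨a, by simp, by simp⟩
  | cons a s ha _ ih =>
    obtain ⟨c, h1, h2⟩ := ih fun x hx => hW (Finset.mem_cons_of_mem hx)
    have hac : a ≠ c := fun e => ha (e ▸ h1)
    have ka : a ∈ E.kept := hW (by simp)
    have kc : c ∈ E.kept := hW (Finset.mem_cons_of_mem h1)
    rcases hr.total a ka c kc hac with h | h
    · refine ⟨c, by simp [h1], fun d hd hdc => ?_⟩
      rcases Finset.mem_cons.1 hd with rfl | hd
      · exact h
      · exact h2 d hd hdc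
    · refine ⟨a, by simp, fun d hd hda => ?_⟩
      have hd := (Finset.mem_cons.1 hd).resolve_left hda
      by_cases hdc : d = c
      · rwa [hdc]
      · exact hr.trans d (hW (Finset.mem_cons_of_mem hd)) c kc a ka (h2 d hd hdc) h

/-- `cur` is the table of the dynamic program for committees of `j` undominated candidates from
`S`: the positive entries `cur c s` exceed the number of connected pairs of such a committee with
last member `c` and a last class of `s` voters by one, and the table covers all these
committees. -/
structure IsTable (E : Election V C) (r : C → C → Prop) (S : Finset C) (j : ℕ)
    (cur : C → ℕ → ℕ) : Prop where
  sound : ∀ c s, cur c s ≠ 0 → ∃ W U, W ⊆ S ∧ W.card = j ∧ E.Ends r W c U ∧ U.card = s ∧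
    E.cons W + 1 = cur c s
  complete : ∀ W ⊆ S, W.card = j → ∃ c U, E.Ends r W c U ∧ E.cons W + 1 ≤ cur c U.card

section Step

variable [DecidableEq V]

/-- The number of voters in the last class of a committee with last member `c` that remain
connected to the supporters of the next member `d`, if the last class has `s` voters. -/
def carry (E : Election V C) (c d : C) (s : ℕ) : ℕ :=
  if (E.supp c ∩ E.supp d).Nonempty then s else 0

/-- The number of voters in the last class after `d` has been added to a committee with last member
`c` and a last class of `s` voters. -/
def grow (E : Election V C) (c d : C) (s : ℕ) : ℕ :=
  E.carry c d s + (E.supp d \ E.supp c).card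

theorem ends_singleton (r : C → C → Prop) (c : C) : E.Ends r {c} c (E.supp c) ∧
    E.cons {c} = (E.supp c).card.choose 2 := by
  have h : Attaches E ∅ c ∅ := ⟨by simp [IsClass], by simp, .inl rfl⟩
  have h1 := h.isClass_insert
  have h2 := h.cons_insert
  simp only [insert_empty_eq, Finset.empty_union] at h1 h2
  exact ⟨⟨by simp, fun d h1 h2 => absurd (Finset.mem_singleton.1 h1) h2, subset_rfl, h1⟩,
    by simpa [cons_empty] using h2⟩

/-- Appending a candidate `d` after the last member `c`. Since every voter approves consecutive
candidates, a supporter of `d` that approves an earlier member also approves `c`, so the new last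
class and the increase of the number of connected pairs depend only on `c`, `d` and the size of the
old last class. -/
theorem Ends.insert (hr : E.IsOrder r) {W : Finset C} {c d : C} {U : Finset V}
    (h : E.Ends r W c U) (hW : W ⊆ E.kept) (hd : d ∈ E.kept) (hcd : r c d) :
    d ∉ W ∧ ∃ U', E.Ends r (insert d W) d U' ∧ U'.card = E.grow c d U.card ∧
      E.cons (insert d W) + (E.carry c d U.card).choose 2 = E.cons W + U'.card.choose 2 := by
  have before : ∀ e ∈ W, r e d := fun e he => by
    by_cases hec : e = c
    · rwa [hec]
    · exact hr.trans e (hW he) c (hW h.mem) d hd (h.last e he hec) hcd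
  have between : ∀ e ∈ W, ∀ v ∈ E.supp d, v ∈ E.supp e → v ∈ E.supp c := fun e he v hvd hve => by
    by_cases hec : e = c
    · rwa [← hec]
    · exact hr.conv e (hW he) c (hW h.mem) d hd (h.last e he hec) hcd v hve hvd
  refine ⟨fun hdW => hr.ne _ _ (before d hdW) rfl, ?_⟩
  by_cases hcon : (E.supp c ∩ E.supp d).Nonempty
  · obtain ⟨x, hx⟩ := hcon
    have hx' := Finset.mem_inter.1 hx
    have hatt : Attaches E W d U := ⟨h.isClass, fun e he v hvd hve =>
      h.supp_subset (between e he v hvd hve), .inr ⟨x, h.supp_subset hx'.1, hx'.2⟩⟩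
    refine ⟨U ∪ E.supp d, ⟨Finset.mem_insert_self _ _, ?_, Finset.subset_union_right,
      hatt.isClass_insert⟩, ?_, ?_⟩
    · intro e he hed
      exact before e ((Finset.mem_insert.1 he).resolve_left hed)
    · rw [grow, carry, if_pos ⟨x, hx⟩, ← Finset.union_sdiff_self_eq_union,
        Finset.card_union_of_disjoint Finset.disjoint_sdiff]
      congr 2
      ext v
      simp only [Finset.mem_sdiff]
      refine and_congr_right fun hvd => not_congr ⟨fun hvU => ?_, fun hv => h.supp_subset hv⟩
      rcases ((h.isClass x (h.supp_subset hx'.1) v).2 hvU).eq_or_exists with rfl | ⟨e, h1, h2⟩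
      · exact hx'.1
      · exact between e h1 v hvd (mem_supp.2 h2)
    · rw [carry, if_pos ⟨x, hx⟩]
      exact hatt.cons_insert
  · have hdis : ∀ v ∈ E.supp d, v ∉ E.supp c := fun v h1 h2 =>
      hcon ⟨v, Finset.mem_inter.2 ⟨h2, h1⟩⟩
    have hatt : Attaches E W d ∅ := ⟨by simp [IsClass], fun e he v hvd hve =>
      absurd (between e he v hvd hve) (hdis v hvd), .inl rfl⟩
    have h1 := hatt.isClass_insert
    have h2 := hatt.cons_insert
    rw [Finset.empty_union] at h1 h2
    refine ⟨E.supp d, ⟨Finset.mem_insert_self _ _, ?_, subset_rfl, h1⟩, ?_, ?_⟩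
    · intro e he hed
      exact before e ((Finset.mem_insert.1 he).resolve_left hed)
    · rw [grow, carry, if_neg hcon, zero_add, Finset.sdiff_eq_self_of_disjoint]
      exact Finset.disjoint_left.2 hdis
    · rw [carry, if_neg hcon]
      exact h2

theorem isTable_one {S : Finset C} {cur : C → ℕ → ℕ}
    (h1 : ∀ c ∈ S, cur c (E.supp c).card = 1 + (E.supp c).card.choose 2)
    (h2 : ∀ c s, cur c s ≠ 0 → c ∈ S ∧ s = (E.supp c).card) : E.IsTable r S 1 cur := by
  refine ⟨fun c s h => ?_, fun W hW hc => ?_⟩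
  · obtain ⟨h3, rfl⟩ := h2 c s h
    refine ⟨{c}, E.supp c, by simpa using h3, by simp, (ends_singleton r c).1, rfl, ?_⟩
    rw [h1 c h3, (ends_singleton r c).2, add_comm]
  · obtain ⟨c, rfl⟩ := Finset.card_eq_one.1 hc
    refine ⟨c, E.supp c, (ends_singleton r c).1, ?_⟩
    rw [h1 c (hW (by simp)), (ends_singleton r c).2, add_comm]

/-- The recursion of the dynamic program: `next d t` is the maximum of the values obtained by
appending `d` to the committees behind the entries of `cur` for which the last class grows to `t`
voters. -/
theorem IsTable.succ (hr : E.IsOrder r) {S : Finset C} (hS : S ⊆ E.kept) {j : ℕ}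
    {cur next : C → ℕ → ℕ} (h : E.IsTable r S j cur)
    (h1 : ∀ c d s, d ∈ S → cur c s ≠ 0 → r c d → s ≤ Fintype.card V →
      E.grow c d s ≤ Fintype.card V →
      cur c s + ((E.grow c d s).choose 2 - (E.carry c d s).choose 2) ≤ next d (E.grow c d s))
    (h2 : ∀ d t, next d t ≠ 0 → ∃ c s, d ∈ S ∧ cur c s ≠ 0 ∧ r c d ∧ t = E.grow c d s ∧
      next d t = cur c s + ((E.grow c d s).choose 2 - (E.carry c d s).choose 2)) :
    E.IsTable r S (j + 1) next := by
  have mono : ∀ c d s, (E.carry c d s).choose 2 ≤ (E.grow c d s).choose 2 := fun c d s =>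
    Nat.choose_le_choose 2 (Nat.le_add_right _ _)
  refine ⟨fun d t hdt => ?_, fun W hW hc => ?_⟩
  · obtain ⟨c, s, hd, k1, k2, k3, k4⟩ := h2 d t hdt
    obtain ⟨W, U, l1, l2, l3, rfl, l5⟩ := h.sound c s k1
    obtain ⟨m1, U', m2, m3, m4⟩ := l3.insert hr (l1.trans hS) (hS hd) k2
    refine ⟨insert d W, U', Finset.insert_subset hd l1, ?_, m2, by rw [m3, k3], ?_⟩
    · rw [Finset.card_insert_of_notMem m1, l2]
    · have := mono c d U.card
      rw [k4, ← l5]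
      rw [m3] at m4
      omega
  · obtain ⟨d, hd, hd'⟩ := hr.exists_last (hW.trans hS) (Finset.card_pos.1 (by omega))
    have hW' : W.erase d ⊆ S := (Finset.erase_subset _ _).trans hW
    obtain ⟨c, U, k1, k2⟩ := h.complete (W.erase d) hW' (by rw [Finset.card_erase_of_mem hd]; omega)
    have hcW := Finset.mem_erase.1 k1.mem
    have hcd := hd' c hcW.2 hcW.1
    obtain ⟨m1, U', m2, m3, m4⟩ := k1.insert hr (hW'.trans hS) (hS (hW hd)) hcd
    rw [Finset.insert_erase hd] at m2 m4
    refine ⟨d, U', m2, ?_⟩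
    have h3 := h1 c d U.card (hW hd) (by omega) hcd (Finset.card_le_univ U)
      (by rw [← m3]; exact Finset.card_le_univ U')
    have := mono c d U.card
    rw [m3] at m4 ⊢
    omega

end Step

/-- The optimum for at most `j + 1` candidates is the optimum for at most `j` candidates or the
largest entry of the table for `j + 1` candidates. -/
theorem IsTable.best_succ {S : Finset C} {j M : ℕ} {cur : C → ℕ → ℕ}
    (h : E.IsTable r S (j + 1) cur) (h1 : ∀ c s, s ≤ Fintype.card V → cur c s ≤ M)
    (h2 : M ≠ 0 → ∃ c s, M = cur c s) :
    E.best S (j + 1) + 1 = max (E.best S j + 1) M := by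
  apply le_antisymm
  · obtain ⟨W, k1, k2, k3⟩ := E.exists_cons_eq_best S (j + 1)
    rw [← k3]
    rcases Nat.le_succ_iff.1 k2 with k2 | k2
    · exact le_max_of_le_left (Nat.succ_le_succ (cons_le_best k1 k2))
    · obtain ⟨c, U, l1, l2⟩ := h.complete W k1 k2
      exact le_max_of_le_right (l2.trans (h1 _ _ (Finset.card_le_univ U)))
  · refine max_le (Nat.succ_le_succ ?_) ?_
    · obtain ⟨W, k1, k2, k3⟩ := E.exists_cons_eq_best S j
      exact k3 ▸ cons_le_best k1 (k2.trans (Nat.le_succ j))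
    · rcases eq_or_ne M 0 with rfl | hM
      · exact Nat.zero_le _
      · obtain ⟨c, s, rfl⟩ := h2 hM
        obtain ⟨W, U, l1, l2, -, -, l5⟩ := h.sound c s hM
        exact l5 ▸ Nat.succ_le_succ (cons_le_best l1 l2.le)

/-- A set of candidates that still contains an optimal committee, and from which no candidate can
be removed without losing this property or having less than `k` members, is optimal. -/
theorem isConsMaximizing_of_minimal {S : Finset C} (hk : E.k ≤ S.card)
    (hbest : E.best (S ∩ E.kept) E.k = E.best E.kept E.k)
    (hmin : ∀ c ∈ S, E.best (S.erase c ∩ E.kept) E.k < E.best E.kept E.k ∨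
      (S.erase c).card < E.k) : E.IsConsMaximizing S := by
  obtain ⟨W, h1, h2, h3⟩ := E.exists_cons_eq_best (S ∩ E.kept) E.k
  refine ⟨le_antisymm (not_lt.1 fun hlt => ?_) hk, fun W' hW' => ?_⟩
  · obtain ⟨c, hc, hcW⟩ := Finset.exists_mem_notMem_of_card_lt_card (h2.trans_lt hlt)
    rcases hmin c hc with h | h
    · refine absurd (cons_le_best (E := E) (S := S.erase c ∩ E.kept) ?_ h2) (not_le.2 ?_)
      · intro d hd
        have := Finset.mem_inter.1 (h1 hd)
        exact Finset.mem_inter.2 ⟨Finset.mem_erase.2 ⟨fun e => hcW (e ▸ hd), this.1⟩, this.2⟩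
      · rwa [h3, hbest]
    · rw [Finset.card_erase_of_mem hc] at h
      omega
  · obtain ⟨W'', k1, k2, k3⟩ := E.exists_subset_kept W'
    calc E.cons W' ≤ E.cons W'' := k3
      _ ≤ E.best E.kept E.k := cons_le_best k1 (k2.trans hW')
      _ = E.cons W := by rw [h3, hbest]
      _ ≤ E.cons S := cons_mono (h1.trans Finset.inter_subset_left)

end Dynamic

end Election

/-! ### Reasoning about commands -/

namespace RAM

theorem iter_induction {α : Type*} {f : ℕ → α → α} (I : ℕ → α → Prop) {N : ℕ} {s : α} (h0 : I 0 s)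
    (h : ∀ i < N, ∀ s, I i s → I (i + 1) (f i s)) : I N (iter f N s) := by
  suffices H : ∀ i ≤ N, I i (iter f i s) from H N le_rfl
  intro i
  induction i with
  | zero => exact fun _ => h0
  | succ i ih => exact fun hi => h i hi _ (ih (by omega))

/-- The arrays that a command may change. -/
def Cmd.arrs : Cmd → Finset ℕ
  | put a _ _ => {a}
  | seq c d => c.arrs ∪ d.arrs
  | forN _ c => c.arrs

/-- The variables that a command may change. -/
def Cmd.vars : Cmd → Finset ℕ
  | put _ _ _ => ∅
  | seq c d => c.vars ∪ d.vars
  | forN x c => insert x c.vars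

@[simp] theorem setVar_arr (s : State) (x y : ℕ) : (s.setVar x y).arr = s.arr := rfl

@[simp] theorem setVar_var (s : State) (x y z : ℕ) :
    (s.setVar x y).var z = if z = x then y else s.var z := by
  simp [State.setVar, Function.update_apply]

@[simp] theorem setArr_var (s : State) (a i y : ℕ) : (s.setArr a i y).var = s.var := rfl

theorem setArr_arr_self (s : State) (a i y j : ℕ) :
    (s.setArr a i y).arr a j = if j = i then y else s.arr a j := by
  simp [State.setArr, Function.update_apply]

theorem setArr_arr_ne (s : State) {a b : ℕ} (i y : ℕ) (h : b ≠ a) :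
    (s.setArr a i y).arr b = s.arr b := by
  simp [State.setArr, h]

theorem Cmd.run_arr {N : ℕ} {c : Cmd} {b : ℕ} (hb : b ∉ c.arrs) (s : State) :
    (c.run N s).arr b = s.arr b := by
  induction c generalizing s with
  | put a i e => exact setArr_arr_ne _ _ _ (by simpa [Cmd.arrs] using hb)
  | seq c d ihc ihd =>
    simp only [Cmd.arrs, Finset.mem_union, not_or] at hb
    rw [Cmd.run, ihd hb.2, ihc hb.1]
  | forN x c ih =>
    refine iter_induction (fun _ (s' : State) => s'.arr b = s.arr b) rfl fun i _ s' h => ?_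
    rw [ih hb, setVar_arr, h]

theorem Cmd.run_var {N : ℕ} {c : Cmd} {x : ℕ} (hx : x ∉ c.vars) (s : State) :
    (c.run N s).var x = s.var x := by
  induction c generalizing s with
  | put a i e => rfl
  | seq c d ihc ihd =>
    simp only [Cmd.vars, Finset.mem_union, not_or] at hx
    rw [Cmd.run, ihd hx.2, ihc hx.1]
  | forN y c ih =>
    simp only [Cmd.vars, Finset.mem_insert, not_or] at hx
    refine iter_induction (fun _ (s' : State) => s'.var x = s.var x) rfl fun i _ s' h => ?_
    rw [ih hx.2, setVar_var, if_neg hx.1, h]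

/-- Fill the `N × N` matrix `a` with the values of `e`, where the variable `0` is the row and the
variable `1` the column. -/
def bulk (a : ℕ) (e : BExp) : Cmd := .forN 0 (.forN 1 (.put a (.idx (.var 0) (.var 1)) e))

theorem idx_inj {N x y p q : ℕ} (hy : y < N) (hq : q < N) (h : N * x + y = N * p + q) :
    x = p ∧ y = q := by
  have hx : x = p := by
    have := congrArg (· / N) h
    simpa [Nat.mul_add_div (show N > 0 by omega), Nat.div_eq_of_lt hy, Nat.div_eq_of_lt hq]
      using this
  subst hx
  exact ⟨rfl, by omega⟩

/-- The hypothesis asks for the value of `e` in all states that agree with the initial one except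
on the array `a` that is being filled. -/
theorem run_bulk {N a : ℕ} {e : BExp} {s : State} {g : ℕ → ℕ → ℕ}
    (h : ∀ s' : State, (∀ b ≠ a, s'.arr b = s.arr b) → s'.var 0 < N → s'.var 1 < N →
      e.eval N s' = g (s'.var 0) (s'.var 1)) {x y : ℕ} (hx : x < N) (hy : y < N) :
    ((bulk a e).run N s).arr a (N * x + y) = g x y := by
  let I : ℕ → State → Prop := fun i s' => (∀ b ≠ a, s'.arr b = s.arr b) ∧
    ∀ x < i, ∀ y < N, s'.arr a (N * x + y) = g x y
  refine (iter_induction I (s := s) (f := fun i s =>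
    (Cmd.forN 1 (.put a (.idx (.var 0) (.var 1)) e)).run N (s.setVar 0 i))
    ⟨fun _ _ => rfl, by simp⟩ ?_).2 x hx y hy
  rintro i hi s1 ⟨h1, h2⟩
  let J : ℕ → State → Prop := fun j s' => (∀ b ≠ a, s'.arr b = s.arr b) ∧ s'.var 0 = i ∧
    (∀ x < i, ∀ y < N, s'.arr a (N * x + y) = g x y) ∧ ∀ y < j, s'.arr a (N * i + y) = g i y
  obtain ⟨k1, -, k3, k4⟩ := iter_induction J (N := N) (s := s1.setVar 0 i) (f := fun j s =>
    (Cmd.put a (.idx (.var 0) (.var 1)) e).run N (s.setVar 1 j))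
    ⟨h1, by simp, h2, by simp⟩ (by
      rintro j hj s2 ⟨l1, l2, l3, l4⟩
      have he := h (s2.setVar 1 j) (by simpa using l1) (by simpa [l2] using hi) (by simpa using hj)
      simp only [setVar_var, zero_ne_one, if_true, if_false, l2] at he
      refine ⟨fun b hb => ?_, by simpa [Cmd.run] using l2, fun x hx y hy => ?_, fun y hy => ?_⟩
      · rw [Cmd.run, setArr_arr_ne _ _ _ hb, setVar_arr, l1 b hb]
      · rw [Cmd.run, setArr_arr_self, if_neg, setVar_arr, l3 x hx y hy]
        simp only [BExp.eval, setVar_var, zero_ne_one, if_true, if_false, l2]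
        intro e
        have := (idx_inj hy hj e).1
        omega
      · rw [Cmd.run, setArr_arr_self, he]
        simp only [BExp.eval, setVar_var, zero_ne_one, if_true, if_false, l2,
          setVar_arr]
        split_ifs with hc
        · rw [(idx_inj (by omega) hj hc).2]
        · refine l4 y ?_
          by_contra hn
          obtain rfl : y = j := by omega
          exact hc rfl)
  refine ⟨k1, fun x hx y hy => ?_⟩
  rcases Nat.lt_succ_iff_lt_or_eq.1 hx with hx | rfl
  · exact k3 x hx y hy
  · exact k4 y hy

/-- The arrays that an expression reads. -/
def BExp.arrs : BExp → Finset ℕ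
  | const _ => ∅
  | var _ => ∅
  | get a i => insert a i.arrs
  | add e f => e.arrs ∪ f.arrs
  | sub e f => e.arrs ∪ f.arrs
  | idx e f => e.arrs ∪ f.arrs
  | ite b e f => b.arrs ∪ (e.arrs ∪ f.arrs)
  | sum _ e => e.arrs
  | sup _ e => e.arrs

/-- The free variables of an expression. -/
def BExp.free : BExp → Finset ℕ
  | const _ => ∅
  | var x => {x}
  | get _ i => i.free
  | add e f => e.free ∪ f.free
  | sub e f => e.free ∪ f.free
  | idx e f => e.free ∪ f.free
  | ite b e f => b.free ∪ (e.free ∪ f.free)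
  | sum x e => e.free.erase x
  | sup x e => e.free.erase x

/-- The value of an expression depends only on the arrays it reads and on its free variables. -/
theorem BExp.eval_congr {N : ℕ} {e : BExp} {s s' : State} (ha : ∀ a ∈ e.arrs, s.arr a = s'.arr a)
    (hx : ∀ x ∈ e.free, s.var x = s'.var x) : e.eval N s = e.eval N s' := by
  induction e generalizing s s' with
  | const c => rfl
  | var x => exact hx x (by simp [free])
  | get a i ih =>
    rw [eval, eval, ha a (by simp [arrs]), ih (fun b hb => ha b (by simp [arrs, hb])) hx]
  | add e f ihe ihf | sub e f ihe ihf | idx e f ihe ihf =>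
    rw [eval, eval, ihe (fun b hb => ha b (by simp [arrs, hb])) fun x h => hx x (by simp [free, h]),
      ihf (fun b hb => ha b (by simp [arrs, hb])) fun x h => hx x (by simp [free, h])]
  | ite b e f ihb ihe ihf =>
    rw [eval, eval, ihe (fun b hb => ha b (by simp [arrs, hb])) fun x h => hx x (by simp [free, h]),
      ihf (fun b hb => ha b (by simp [arrs, hb])) fun x h => hx x (by simp [free, h]),
      ihb (fun b hb => ha b (by simp [arrs, hb])) fun x h => hx x (by simp [free, h])]
  | sum x e ih | sup x e ih =>
    rw [eval, eval]
    congr 1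
    funext i
    refine ih ha fun z hz => ?_
    by_cases hzx : z = x
    · simp [hzx]
    · simp [hzx, hx z (by simp [free, hz, hzx])]

/-- The special case of `run_bulk` in which the values are given by the initial state. -/
theorem run_bulk_eval {N a : ℕ} {e : BExp} {s : State} (ha : a ∉ e.arrs)
    (hx : e.free ⊆ {0, 1}) {x y : ℕ} (h1 : x < N) (h2 : y < N) :
    ((bulk a e).run N s).arr a (N * x + y) = e.eval N ((s.setVar 0 x).setVar 1 y) :=
  run_bulk (g := fun x y => e.eval N ((s.setVar 0 x).setVar 1 y)) (fun s' hs' _ _ =>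
    BExp.eval_congr (fun b hb => hs' b (ne_of_mem_of_not_mem hb ha)) fun z hz => by
      have := hx hz
      simp only [Finset.mem_insert, Finset.mem_singleton] at this
      rcases this with rfl | rfl <;> simp) h1 h2

/-- Repeating a command in a loop that does not use its variable. -/
theorem run_forN {N x T : ℕ} {c : Cmd} (I : ℕ → (ℕ → ℕ → ℕ) → Prop)
    (h : ∀ t s, I t s.arr → I (t + T) (c.run N s).arr) (t : ℕ) (s : State) (hs : I t s.arr) :
    I (t + N * T) ((Cmd.forN x c).run N s).arr :=
  iter_induction (fun i (s' : State) => I (t + i * T) s'.arr) (by simpa using hs)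
    fun i _ s' hs' => by
      have := h _ (s'.setVar x i) hs'
      rwa [add_assoc, ← Nat.succ_mul] at this

namespace BExp

/-- The entry `(e, f)` of the matrix `a`. -/
abbrev mat (a : ℕ) (e f : BExp) : BExp := .get a (.idx e f)

/-- `e < f`, as a test. -/
abbrev lt (e f : BExp) : BExp := .sub f e

/-- The conditional with alternative `0`. -/
abbrev when (b e : BExp) : BExp := .ite b e (.const 0)

/-- `g` if `e = f`, and `0` otherwise. -/
abbrev whenEq (e f g : BExp) : BExp := .ite (.sub e f) (.const 0) (.ite (.sub f e) (.const 0) g)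

/-- The larger of two values. -/
def maxOf (e f : BExp) : BExp := .add e (.sub f e)

/-- The number of pairs of `e` objects, computed as `0 + 1 + ⋯ + (e - 1)`. The bound variable is
`9`. -/
def pairs (e : BExp) : BExp := .sum 9 (when (lt (.var 9) e) (.var 9))

@[simp] theorem eval_maxOf (N : ℕ) (e f : BExp) (s : State) :
    (maxOf e f).eval N s = max (e.eval N s) (f.eval N s) := by
  simp only [maxOf, eval, Nat.max_def]
  split <;> omega

theorem eval_when (N : ℕ) (b e : BExp) (s : State) :
    (when b e).eval N s = if b.eval N s ≠ 0 then e.eval N s else 0 := rfl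

theorem eval_whenEq (N : ℕ) (e f g : BExp) (s : State) :
    (whenEq e f g).eval N s = if e.eval N s = f.eval N s then g.eval N s else 0 := by
  simp only [eval]
  by_cases h : e.eval N s = f.eval N s
  · simp [h]
  · rw [if_neg h]
    by_cases h1 : e.eval N s - f.eval N s = 0
    · have h2 : f.eval N s - e.eval N s ≠ 0 := by omega
      simp [h1, h2]
    · simp [h1]

theorem sum_range_ite_lt {N k : ℕ} (hk : k ≤ N) (f : ℕ → ℕ) :
    ∑ i ∈ Finset.range N, (if k - i ≠ 0 then f i else 0) = ∑ i ∈ Finset.range k, f i := by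
  rw [← Finset.sum_filter]
  congr 1
  ext i
  simp only [Finset.mem_filter, Finset.mem_range]
  omega

theorem eval_pairs {N : ℕ} {e : BExp} {s : State} {k : ℕ}
    (he : ∀ i, e.eval N (s.setVar 9 i) = k) (hk : k ≤ N) : (pairs e).eval N s = k.choose 2 := by
  simp only [pairs, eval, he, setVar_var, if_true]
  rw [sum_range_ite_lt hk, Finset.sum_range_id, Nat.choose_two_right]

end BExp

end RAM

/-! ### Preparation: undominated candidates and their order -/

namespace Election

open RAM Consecutive

variable {n m : ℕ} (E : Election (Fin n) (Fin m)) (N : ℕ)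

theorem mem_keptIdx {E : Election (Fin n) (Fin m)} {c : ℕ} : c ∈ E.keptIdx ↔ c < m ∧
    ∀ d < m, E.suppIdx c ⊆ E.suppIdx d → E.suppIdx d ⊆ E.suppIdx c ∧ c ≤ d := by
  have key : ∀ (c d : ℕ) (hc : c < m) (hd : d < m), E.supp ⟨c, hc⟩ ⊆ E.supp ⟨d, hd⟩ ↔
      E.suppIdx c ⊆ E.suppIdx d := by
    intro c d hc hd
    constructor
    · rintro h v ⟨_, hv⟩
      exact ⟨hd, mem_supp.1 (h (mem_supp.2 hv))⟩
    · rintro h v hv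
      obtain ⟨_, hv⟩ := h ⟨hc, mem_supp.1 hv⟩
      exact mem_supp.2 hv
  constructor
  · rintro ⟨hc, h⟩
    refine ⟨hc, fun d hd hcd => ?_⟩
    obtain ⟨h1, h2⟩ := mem_kept.1 h ⟨d, hd⟩ ((key _ _ _ _).2 hcd)
    exact ⟨(key _ _ _ _).1 h1, h2⟩
  · rintro ⟨hc, h⟩
    refine ⟨hc, mem_kept.2 fun d hcd => ?_⟩
    obtain ⟨h1, h2⟩ := h d d.2 ((key _ _ _ d.2).1 hcd)
    exact ⟨(key _ _ d.2 _).2 h1, h2⟩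

open Classical in
/-- The arrays hold `n`, `m`, `k` (array `2`) and the approval matrix with rows of length `N`
(array `3`). -/
structure HasApprovals (a : ℕ → ℕ → ℕ) : Prop where
  n_eq : a 2 0 = n
  m_eq : a 2 1 = m
  k_eq : a 2 2 = E.k
  matrix : ∀ v < N, ∀ c < N,
    a 3 (N * v + c) = if ∃ h : v < n, (⟨v, h⟩ : Fin n) ∈ E.suppIdx c then 1 else 0

/-- In addition, array `4` marks the undominated candidates. -/
structure HasKept (a : ℕ → ℕ → ℕ) : Prop extends HasApprovals E N a where
  kept : ∀ c < N, ∀ y < N, a 4 (N * c + y) ≠ 0 ↔ c ∈ E.keptIdx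

/-- The number of voters that support the candidate in the variable `x` but not the one in the
variable `y`. The bound variable is `3`. -/
def lackExp (x y : ℕ) : BExp :=
  .sum 3 (.sub (.mat 3 (.var 3) (.var x)) (.mat 3 (.var 3) (.var y)))

/-- The number of voters that support the candidates in the variables `y` and `z` but not the one in
the variable `x`. The bound variable is `3`. -/
def separateExp (x y z : ℕ) : BExp :=
  .sum 3 (.ite (.mat 3 (.var 3) (.var x)) (.const 0)
    (.when (.mat 3 (.var 3) (.var y)) (.mat 3 (.var 3) (.var z))))

variable {E N}

theorem HasApprovals.congr {a b : ℕ → ℕ → ℕ} (h : HasApprovals E N a) (h2 : b 2 = a 2)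
    (h3 : b 3 = a 3) : HasApprovals E N b :=
  ⟨by rw [h2, h.n_eq], by rw [h2, h.m_eq], by rw [h2, h.k_eq], fun v hv c hc => by
    rw [h3, h.matrix v hv c hc]⟩

theorem HasKept.congr {a b : ℕ → ℕ → ℕ} (h : HasKept E N a) (h2 : b 2 = a 2)
    (h3 : b 3 = a 3) (h4 : b 4 = a 4) : HasKept E N b :=
  ⟨h.toHasApprovals.congr h2 h3, fun c hc y hy => by rw [h4]; exact h.kept c hc y hy⟩

theorem HasApprovals.lackExp_eq_zero {s : State} (h : HasApprovals E N s.arr) (hn : n ≤ N)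
    {x y : ℕ} (hx3 : x ≠ 3) (hy3 : y ≠ 3) (hx : s.var x < N) (hy : s.var y < N) :
    (lackExp x y).eval N s = 0 ↔ E.suppIdx (s.var x) ⊆ E.suppIdx (s.var y) := by
  simp only [lackExp, BExp.eval, setVar_var, setVar_arr, hx3, hy3, if_true, if_false,
    Finset.sum_eq_zero_iff, Finset.mem_range]
  constructor
  · intro hs v hv
    have := hs v (v.2.trans_le hn)
    rw [h.matrix _ (v.2.trans_le hn) _ hx, h.matrix _ (v.2.trans_le hn) _ hy,
      if_pos ⟨v.2, hv⟩] at this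
    by_contra hno
    rw [if_neg fun ⟨_, h⟩ => hno h] at this
    omega
  · intro hs v hv
    rw [h.matrix _ hv _ hx, h.matrix _ hv _ hy]
    split_ifs with h1 h2
    · rfl
    · exact absurd (h1.imp fun _ h => hs h) h2
    all_goals rfl

theorem HasApprovals.separateExp_ne_zero {s : State} (h : HasApprovals E N s.arr) (hn : n ≤ N)
    {x y z : ℕ} (hx3 : x ≠ 3) (hy3 : y ≠ 3) (hz3 : z ≠ 3) (hx : s.var x < N) (hy : s.var y < N)
    (hz : s.var z < N) : (separateExp x y z).eval N s ≠ 0 ↔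
      ∃ v, v ∉ E.suppIdx (s.var x) ∧ v ∈ E.suppIdx (s.var y) ∧ v ∈ E.suppIdx (s.var z) := by
  simp only [separateExp, BExp.eval, setVar_var, setVar_arr, hx3, hy3, hz3, if_true, if_false,
    Ne, Finset.sum_eq_zero_iff, Finset.mem_range, not_forall]
  constructor
  · rintro ⟨v, hv, hs⟩
    rw [h.matrix _ hv _ hx, h.matrix _ hv _ hy, h.matrix _ hv _ hz] at hs
    by_cases h2 : ∃ h : v < n, (⟨v, h⟩ : Fin n) ∈ E.suppIdx (s.var y)
    · by_cases h1 : ∃ h : v < n, (⟨v, h⟩ : Fin n) ∈ E.suppIdx (s.var x)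
      · simp [h1] at hs
      · by_cases h3 : ∃ h : v < n, (⟨v, h⟩ : Fin n) ∈ E.suppIdx (s.var z)
        · exact ⟨⟨v, h2.1⟩, fun h => h1 ⟨h2.1, h⟩, h2.2, h3.2⟩
        · simp [h3] at hs
    · simp [h2] at hs
  · rintro ⟨v, h1, h2, h3⟩
    refine ⟨v, v.2.trans_le hn, ?_⟩
    rw [h.matrix _ (v.2.trans_le hn) _ hx, h.matrix _ (v.2.trans_le hn) _ hy,
      h.matrix _ (v.2.trans_le hn) _ hz]
    simp [h1, h2, h3]

/-- Copy the approval matrix from array `0`, where its rows have length `m`. The index `v * m` is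
computed as a sum of `m` copies of `v`. -/
def matrixCmd : Cmd :=
  bulk 3 (.when (.lt (.var 0) (.get 2 (.const 0))) (.when (.lt (.var 1) (.get 2 (.const 1)))
    (.get 0 (.add (.sum 2 (.when (.lt (.var 2) (.get 2 (.const 1))) (.var 0))) (.var 1)))))

open Classical in
theorem hasApprovals_matrixCmd {s : State} (hm : m ≤ N) (h0 : s.arr 0 = E.input.arr 0)
    (h1 : s.arr 2 0 = n) (h2 : s.arr 2 1 = m) (h3 : s.arr 2 2 = E.k) :
    HasApprovals E N (matrixCmd.run N s).arr := by
  have hf : (matrixCmd.run N s).arr 2 = s.arr 2 := Cmd.run_arr (by decide) s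
  refine ⟨by rw [hf, h1], by rw [hf, h2], by rw [hf, h3], fun v hv c hc => ?_⟩
  rw [matrixCmd, run_bulk (g := fun v c => if ∃ h : v < n, (⟨v, h⟩ : Fin n) ∈ E.suppIdx c then 1
    else 0) (fun s' hs' _ _ => ?_) hv hc]
  clear hv hc v c
  generalize hv : s'.var 0 = v
  generalize hc : s'.var 1 = c
  simp only [BExp.eval, hs' 2 (by decide), hs' 0 (by decide), h0, h1, h2, setVar_var, setVar_arr,
    hv, hc, if_true, if_false, show (0 : ℕ) ≠ 2 by decide]
  rw [BExp.sum_range_ite_lt hm fun _ => v]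
  by_cases c1 : v < n
  · by_cases c2 : c < m
    · rw [if_pos (by omega), if_pos (by omega)]
      simp only [input, true_and, Finset.sum_const, Finset.card_range, smul_eq_mul]
      congr 1
      apply propext
      constructor
      · rintro ⟨v', c', e, h⟩
        rw [mul_comm v'.1] at e
        obtain ⟨rfl, rfl⟩ := idx_inj c2 c'.2 e
        exact ⟨c1, c2, h⟩
      · rintro ⟨_, _, h⟩
        exact ⟨⟨v, c1⟩, ⟨c, c2⟩, by rw [mul_comm], h⟩
    · rw [if_pos (by omega), if_neg (by omega), if_neg]
      rintro ⟨_, h, _⟩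
      exact c2 h
  · rw [if_neg (by omega), if_neg]
    rintro ⟨h, _⟩
    exact c1 h

/-- Mark the undominated candidates in array `4`. -/
def keptCmd : Cmd :=
  bulk 4 (.when (.lt (.var 0) (.get 2 (.const 1))) (.ite
    (.sup 2 (.when (.lt (.var 2) (.get 2 (.const 1))) (.ite (lackExp 0 2) (.const 0)
      (.ite (lackExp 2 0) (.const 1) (.lt (.var 2) (.var 0)))))) (.const 0) (.const 1)))

open Classical in
theorem hasKept_keptCmd {s : State} (hn : n ≤ N) (hm : m ≤ N) (h : HasApprovals E N s.arr) :
    HasKept E N (keptCmd.run N s).arr := by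
  refine ⟨h.congr (Cmd.run_arr (by decide) s) (Cmd.run_arr (by decide) s), fun c hc y hy => ?_⟩
  rw [keptCmd, run_bulk (g := fun c _ => if c ∈ E.keptIdx then 1 else 0) (fun s' hs' hc _ => ?_)
    hc hy]
  · split_ifs <;> simp [*]
  have h' : HasApprovals E N s'.arr := h.congr (hs' 2 (by decide)) (hs' 3 (by decide))
  have hd : ∀ d < N, ((.when (.lt (.var 2) (.get 2 (.const 1))) (.ite (lackExp 0 2) (.const 0)
      (.ite (lackExp 2 0) (.const 1) (.lt (.var 2) (.var 0)))) : BExp).eval N (s'.setVar 2 d) = 0 ↔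
      (d < m → E.suppIdx (s'.var 0) ⊆ E.suppIdx d →
        E.suppIdx d ⊆ E.suppIdx (s'.var 0) ∧ s'.var 0 ≤ d)) := by
    intro d hd
    have h'' : HasApprovals E N (s'.setVar 2 d).arr := h'
    have e1 := h''.lackExp_eq_zero hn (x := 0) (y := 2) (by decide) (by decide) (by simpa)
      (by simpa)
    have e2 := h''.lackExp_eq_zero hn (x := 2) (y := 0) (by decide) (by decide) (by simpa)
      (by simpa)
    simp only [setVar_var, if_true, if_false, show (0 : ℕ) ≠ 2 by decide] at e1 e2
    simp only [BExp.eval, Ne, e1, e2, setVar_var, setVar_arr, h'.m_eq, if_true, if_false,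
      show (0 : ℕ) ≠ 2 by decide]
    by_cases c1 : d < m <;> by_cases c2 : E.suppIdx (s'.var 0) ⊆ E.suppIdx d <;>
      by_cases c3 : E.suppIdx d ⊆ E.suppIdx (s'.var 0) <;>
      simp [c1, c2, c3, Nat.sub_eq_zero_iff_le]
  have hsup : (BExp.sup 2 (.when (.lt (.var 2) (.get 2 (.const 1))) (.ite (lackExp 0 2) (.const 0)
      (.ite (lackExp 2 0) (.const 1) (.lt (.var 2) (.var 0)))))).eval N s' = 0 ↔
      ∀ d < m, E.suppIdx (s'.var 0) ⊆ E.suppIdx d →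
        E.suppIdx d ⊆ E.suppIdx (s'.var 0) ∧ s'.var 0 ≤ d := by
    rw [BExp.eval, ← Nat.bot_eq_zero, Finset.sup_eq_bot_iff]
    simp only [Finset.mem_range, Nat.bot_eq_zero]
    exact ⟨fun h d hdm => (hd d (hdm.trans_le hm)).1 (h d (hdm.trans_le hm)) hdm,
      fun h d hdN => (hd d hdN).2 (h d)⟩
  generalize BExp.sup 2 _ = e at hsup ⊢
  by_cases c1 : s'.var 0 < m
  · have : m - s'.var 0 ≠ 0 := by omega
    simp only [mem_keptIdx, BExp.eval, h'.m_eq, Ne, this, c1, true_and, not_false_eq_true, if_true]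
    by_cases c2 : e.eval N s' = 0
    · rw [if_neg (not_not.2 c2), if_pos (hsup.1 c2)]
    · rw [if_pos c2, if_neg (mt hsup.2 c2)]
  · have : m - s'.var 0 = 0 := by omega
    simp [mem_keptIdx, BExp.eval, h'.m_eq, c1, this]

/-- There is a forcing step from `x` to `(x.1, r)`. -/
def SndStep (E : Election (Fin n) (Fin m)) (x : ℕ × ℕ) (r : ℕ) : Prop :=
  (x.1 ∈ E.keptIdx ∧ x.2 ∈ E.keptIdx) ∧ r ∈ E.keptIdx ∧
    ∃ v, v ∉ E.suppIdx x.1 ∧ v ∈ E.suppIdx x.2 ∧ v ∈ E.suppIdx r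

/-- There is a forcing step from `x` to `(r, x.2)`. -/
def FstStep (E : Election (Fin n) (Fin m)) (x : ℕ × ℕ) (r : ℕ) : Prop :=
  (x.1 ∈ E.keptIdx ∧ x.2 ∈ E.keptIdx) ∧ r ∈ E.keptIdx ∧
    ∃ v, v ∉ E.suppIdx x.2 ∧ v ∈ E.suppIdx x.1 ∧ v ∈ E.suppIdx r

theorem SndStep.force {x : ℕ × ℕ} {r : ℕ} (h : SndStep E x r) :
    Force E.keptIdx E.suppIdx x (x.1, r) :=
  ⟨⟨h.1.1, h.1.2, h.1.1, h.2.1⟩, .inl ⟨rfl, h.2.2⟩⟩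

theorem FstStep.force {x : ℕ × ℕ} {r : ℕ} (h : FstStep E x r) :
    Force E.keptIdx E.suppIdx x (r, x.2) :=
  ⟨⟨h.1.1, h.1.2, h.2.1, h.1.2⟩, .inr ⟨rfl, h.2.2⟩⟩

/-- One round of propagation of labels along forcing steps. -/
noncomputable def labelStep (E : Election (Fin n) (Fin m)) (N : ℕ) (f : ℕ × ℕ → ℕ) (x : ℕ × ℕ) :
    ℕ := by
  classical
  exact max (f x) ((Finset.range N).sup fun r =>
    max (if SndStep E x r then f (x.1, r) else 0)
      (if FstStep E x r then f (r, x.2) else 0))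

/-- The labels after `t` rounds. -/
noncomputable def label (E : Election (Fin n) (Fin m)) (N t : ℕ) : ℕ × ℕ → ℕ :=
  (labelStep E N)^[t] fun x => N * x.1 + x.2

theorem label_succ (t : ℕ) : label E N (t + 1) = labelStep E N (label E N t) :=
  Function.iterate_succ_apply' _ _ _

theorem isLabel_label (hm : m ≤ N) (hN : 0 < N) :
    IsLabel E.keptIdx E.suppIdx N (label E N (N ^ 4)) := by
  classical
  have hK : ∀ a ∈ E.keptIdx, a < N := fun a ⟨ha, _⟩ => ha.trans_le hm
  refine isLabel_of_rounds hN hK (label E N) (fun _ => rfl) (fun t x => ?_) (fun t x y h => ?_)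
    (fun t x => ?_) fun t h x h1 h2 => ?_
  · rw [label_succ]
    exact le_max_left _ _
  · rw [label_succ]
    refine le_max_of_le_right ?_
    obtain ⟨y1, y2⟩ := y
    rcases h.2 with ⟨h1, hv⟩ | ⟨h1, hv⟩
    · dsimp only at h1
      subst h1
      refine le_trans ?_ (Finset.le_sup (b := y2) (Finset.mem_range.2 (hK _ h.1.2.2.2)))
      rw [if_pos ⟨⟨h.1.1, h.1.2.1⟩, h.1.2.2.2, hv⟩]
      exact le_max_left _ _
    · dsimp only at h1
      subst h1
      refine le_trans ?_ (Finset.le_sup (b := y1) (Finset.mem_range.2 (hK _ h.1.2.2.1)))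
      have hs : FstStep E x y1 := ⟨⟨h.1.1, h.1.2.1⟩, h.1.2.2.1, hv⟩
      simp only [if_pos hs]
      exact le_max_right _ _
  · rw [label_succ]
    generalize label E N t = f
    by_contra! hno
    obtain ⟨h1, h2⟩ := hno
    refine h1 (max_eq_left ?_)
    refine Finset.sup_le fun r hr => ?_
    by_contra hlt
    obtain ⟨r, hr', hr⟩ := Finset.exists_mem_eq_sup (Finset.range N) ⟨0, by simpa using hN⟩ fun r =>
      max (if SndStep E x r then f (x.1, r) else 0)
      (if FstStep E x r then f (r, x.2) else 0)
    have hs : labelStep E N f x = max (f x) _ := rfl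
    rw [hr] at hs
    have hx : f x ≠ labelStep E N f x := fun e => h1 e.symm
    split_ifs at hs with c1 c2 c2
    · rcases max_choice (f x) (max (f (x.1, r)) (f (r, x.2))) with e | e
      · exact h1 (hs.trans e)
      · rcases max_choice (f (x.1, r)) (f (r, x.2)) with e' | e'
        · exact h2 _ c1.force (hs.trans (e.trans e'))
        · exact h2 _ c2.force (hs.trans (e.trans e'))
    · rw [max_eq_left (Nat.zero_le (f (x.1, r)))] at hs
      rcases max_choice (f x) (f (x.1, r)) with e | e
      · exact h1 (hs.trans e)
      · exact h2 _ c1.force (hs.trans e)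
    · rw [max_eq_right (Nat.zero_le (f (r, x.2)))] at hs
      rcases max_choice (f x) (f (r, x.2)) with e | e
      · exact h1 (hs.trans e)
      · exact h2 _ c2.force (hs.trans e)
    · simp at hs
      exact h1 hs
  · rw [label_succ (t + 1), label_succ t]
    rw [label_succ] at h
    generalize label E N t = f at h
    have e : ∀ r < N, labelStep E N f (x.1, r) = f (x.1, r) ∧
        labelStep E N f (r, x.2) = f (r, x.2) := fun r hr => ⟨h _ h1 hr, h _ hr h2⟩
    generalize hg : labelStep E N f = g at *
    conv_rhs => rw [← hg]
    unfold labelStep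
    rw [h x h1 h2]
    congr 1
    refine Finset.sup_congr rfl fun r hr => ?_
    rw [(e r (Finset.mem_range.1 hr)).1, (e r (Finset.mem_range.1 hr)).2]

/-- The value of one round of propagation at the entry given by the variables `0` and `1`. Array `5`
holds the labels. -/
def labelExp : BExp :=
  .maxOf (.mat 5 (.var 0) (.var 1)) (.when (.mat 4 (.var 0) (.const 0)) <|
    .when (.mat 4 (.var 1) (.const 0)) <| .sup 2 <| .when (.mat 4 (.var 2) (.const 0)) <|
      .maxOf (.when (separateExp 0 1 2) (.mat 5 (.var 0) (.var 2)))
        (.when (separateExp 1 0 2) (.mat 5 (.var 2) (.var 1))))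

/-- A round of propagation, with array `6` for the new labels. -/
def roundCmd : Cmd := .seq (bulk 6 labelExp) (bulk 5 (.mat 6 (.var 0) (.var 1)))

/-- Initialize the labels and run `N ^ 4` rounds of propagation. -/
def labelCmd : Cmd :=
  .seq (bulk 5 (.idx (.var 0) (.var 1)))
    (.forN 10 (.forN 10 (.forN 10 (.forN 10 roundCmd))))

theorem eval_labelExp {s : State} (hn : n ≤ N) (h : HasKept E N s.arr) {f : ℕ × ℕ → ℕ}
    (hf : ∀ x < N, ∀ y < N, s.arr 5 (N * x + y) = f (x, y)) (h0 : s.var 0 < N) (h1 : s.var 1 < N) :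
    labelExp.eval N s = labelStep E N f (s.var 0, s.var 1) := by
  have hN : 0 < N := by omega
  rw [labelExp, BExp.eval_maxOf, labelStep]
  congr 1
  · simp only [BExp.eval]
    exact hf _ h0 _ h1
  · by_cases k0 : s.var 0 ∈ E.keptIdx ∧ s.var 1 ∈ E.keptIdx
    · obtain ⟨k0, k1⟩ := k0
      have e0 : s.arr 4 (N * s.var 0 + 0) ≠ 0 := (h.kept _ h0 0 hN).2 k0
      have e1 : s.arr 4 (N * s.var 1 + 0) ≠ 0 := (h.kept _ h1 0 hN).2 k1
      rw [BExp.eval, if_pos (by exact e0), BExp.eval, if_pos (by exact e1), BExp.eval]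
      refine Finset.sup_congr (s₁ := Finset.range N) rfl ?_
      intro r hr
      have hr := Finset.mem_range.1 hr
      have h' : HasKept E N (s.setVar 2 r).arr := h
      have q1 := h'.separateExp_ne_zero hn (x := 0) (y := 1) (z := 2) (by decide) (by decide)
        (by decide) (by simpa) (by simpa) (by simpa)
      have q2 := h'.separateExp_ne_zero hn (x := 1) (y := 0) (z := 2) (by decide) (by decide)
        (by decide) (by simpa) (by simpa) (by simpa)
      simp only [setVar_var, if_true, if_false, show (0 : ℕ) ≠ 2 by decide,
        show (1 : ℕ) ≠ 2 by decide] at q1 q2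
      simp only [setVar_var, setVar_arr, if_true, if_false, show (0 : ℕ) ≠ 2 by decide,
        show (1 : ℕ) ≠ 2 by decide, BExp.eval_maxOf, BExp.eval, hf _ h0 _ hr, hf _ hr _ h1]
      have f1 : SndStep E (s.var 0, s.var 1) r ↔ r ∈ E.keptIdx ∧ ∃ v, v ∉ E.suppIdx (s.var 0) ∧
          v ∈ E.suppIdx (s.var 1) ∧ v ∈ E.suppIdx r := and_iff_right ⟨k0, k1⟩
      have f2 : FstStep E (s.var 0, s.var 1) r ↔ r ∈ E.keptIdx ∧ ∃ v, v ∉ E.suppIdx (s.var 1) ∧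
          v ∈ E.suppIdx (s.var 0) ∧ v ∈ E.suppIdx r := and_iff_right ⟨k0, k1⟩
      rw [← q1] at f1
      rw [← q2] at f2
      by_cases k2 : r ∈ E.keptIdx
      · rw [if_pos ((h.kept _ hr 0 hN).2 k2)]
        simp only [f1, f2, k2, true_and]
      · rw [if_neg (mt (h.kept _ hr 0 hN).1 k2)]
        simp [f1, f2, k2]
    · have f1 : ∀ r, ¬SndStep E (s.var 0, s.var 1) r := fun r h => k0 h.1
      have f2 : ∀ r, ¬FstStep E (s.var 0, s.var 1) r := fun r h => k0 h.1
      simp only [f1, f2, if_false, max_self]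
      rw [← h.kept _ h0 0 hN, ← h.kept _ h1 0 hN, not_and_or, not_not, not_not] at k0
      rw [← Nat.bot_eq_zero, Finset.sup_bot, Nat.bot_eq_zero]
      rcases k0 with k0 | k0 <;> rw [add_zero] at k0 <;> simp +contextual [BExp.eval, k0]

/-- Arrays `2`, `3`, `4` have the meaning described in `HasKept`, and array `5` holds the labels
after `t` rounds. -/
structure HasLabel (E : Election (Fin n) (Fin m)) (N t : ℕ) (a : ℕ → ℕ → ℕ) : Prop
    extends HasKept E N a where
  label : ∀ x < N, ∀ y < N, a 5 (N * x + y) = label E N t (x, y)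

theorem HasLabel.roundCmd {t : ℕ} {s : State} (hn : n ≤ N) (h : HasLabel E N t s.arr) :
    HasLabel E N (t + 1) (roundCmd.run N s).arr := by
  refine ⟨h.toHasKept.congr (Cmd.run_arr (by decide) s) (Cmd.run_arr (by decide) s)
    (Cmd.run_arr (by decide) s), fun x hx y hy => ?_⟩
  rw [Election.roundCmd, Cmd.run, run_bulk (g := fun x y => Election.label E N (t + 1) (x, y))
    (fun s' hs' h0 h1 => ?_) hx hy]
  simp only [BExp.eval, hs' 6 (by decide)]
  rw [run_bulk (g := fun x y => Election.label E N (t + 1) (x, y)) (fun s' hs' h0 h1 => ?_) h0 h1]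
  rw [label_succ]
  refine eval_labelExp hn (h.toHasKept.congr (hs' 2 (by decide)) (hs' 3 (by decide))
    (hs' 4 (by decide))) (fun x hx y hy => ?_) h0 h1
  rw [hs' 5 (by decide), h.label x hx y hy]

theorem hasLabel_labelCmd {s : State} (hn : n ≤ N) (h : HasKept E N s.arr) :
    HasLabel E N (N ^ 4) (labelCmd.run N s).arr := by
  have h0 : HasLabel E N 0 ((bulk 5 (.idx (.var 0) (.var 1))).run N s).arr := by
    refine ⟨h.congr (Cmd.run_arr (by decide) s) (Cmd.run_arr (by decide) s)
      (Cmd.run_arr (by decide) s), fun x hx y hy => ?_⟩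
    rw [run_bulk (g := fun x y => N * x + y) (fun s' _ _ _ => rfl) hx hy]
    rfl
  have h1 := run_forN (x := 10) (HasLabel E N) (T := _) (run_forN (x := 10) _ (run_forN (x := 10) _
    (run_forN (x := 10) _ (T := 1) (N := N) (c := roundCmd) fun t s hs => hs.roundCmd hn))) 0 _ h0
  rw [show 0 + N * (N * (N * (N * 1))) = N ^ 4 by ring] at h1
  exact h1

/-! ### Tables for the dynamic program -/

/-- The data of the dynamic program: `r` (array `7`), whether two candidates have a common supporter
(array `8`), and the number of voters that support the second candidate but not the first one
(array `9`). -/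
structure HasData (E : Election (Fin n) (Fin m)) (N : ℕ) (r : Fin m → Fin m → Prop)
    (a : ℕ → ℕ → ℕ) : Prop extends HasKept E N a where
  order : ∀ p q : Fin m, p ∈ E.kept → q ∈ E.kept → (a 7 (N * p + q) ≠ 0 ↔ r p q)
  common : ∀ p q : Fin m, a 8 (N * p + q) ≠ 0 ↔ (E.supp p ∩ E.supp q).Nonempty
  diff : ∀ p q : Fin m, a 9 (N * p + q) = (E.supp q \ E.supp p).card

/-- Fill the arrays described in `HasData`. -/
def dataCmd : Cmd :=
  .seq (bulk 7 (.sub (.mat 5 (.var 0) (.var 1)) (.mat 5 (.var 1) (.var 0)))) <|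
    .seq (bulk 8 (.sum 2 (.when (.mat 3 (.var 2) (.var 0)) (.mat 3 (.var 2) (.var 1)))))
      (bulk 9 (lackExp 1 0))

theorem HasApprovals.matrix_fin {a : ℕ → ℕ → ℕ} (h : HasApprovals E N a) (hm : m ≤ N) {v : ℕ}
    (hv : v < N) (c : Fin m) :
    a 3 (N * v + c) = if ∃ h : v < n, (⟨v, h⟩ : Fin n) ∈ E.supp c then 1 else 0 := by
  classical
  rw [h.matrix v hv c (c.2.trans_le hm)]
  have : (∃ h : v < n, (⟨v, h⟩ : Fin n) ∈ E.suppIdx c) ↔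
      ∃ h : v < n, (⟨v, h⟩ : Fin n) ∈ E.supp c :=
    exists_congr fun h => ⟨fun ⟨_, h⟩ => mem_supp.2 h, fun h => ⟨c.2, mem_supp.1 h⟩⟩
  simp only [this]

theorem sum_range_eq_card (hn : n ≤ N) (U : Finset (Fin n)) :
    ∑ v ∈ Finset.range N, (if ∃ h : v < n, (⟨v, h⟩ : Fin n) ∈ U then 1 else 0) = U.card := by
  rw [← Finset.sum_subset (Finset.range_subset_range.2 hn), Finset.sum_range]
  · simp
  · intro v _ hv
    rw [if_neg]
    rintro ⟨h, -⟩
    exact hv (Finset.mem_range.2 h)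

theorem HasApprovals.sum_matrix {a : ℕ → ℕ → ℕ} (h : HasApprovals E N a) (hn : n ≤ N) (hm : m ≤ N)
    (c : Fin m) : ∑ v ∈ Finset.range N, a 3 (N * v + c) = (E.supp c).card := by
  rw [← sum_range_eq_card hn]
  exact Finset.sum_congr rfl fun v hv => h.matrix_fin hm (Finset.mem_range.1 hv) c

theorem hasData_dataCmd {s : State} (hn : n ≤ N) (hm : m ≤ N) {t : ℕ} (h : HasLabel E N t s.arr) :
    HasData E N (fun p q => Prec (label E N t) p q) (dataCmd.run N s).arr := by
  have lt : ∀ p : Fin m, (p : ℕ) < N := fun p => p.2.trans_le hm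
  refine ⟨h.toHasKept.congr (Cmd.run_arr (by decide) s) (Cmd.run_arr (by decide) s)
    (Cmd.run_arr (by decide) s), fun p q _ _ => ?_, fun p q => ?_, fun p q => ?_⟩
  · rw [dataCmd, Cmd.run, Cmd.run, Cmd.run_arr (b := 7) (by decide),
      Cmd.run_arr (b := 7) (by decide),
      run_bulk (g := fun p q => label E N t (p, q) - label E N t (q, p)) (fun s' hs' h0 h1 => ?_)
      (lt p) (lt q), Prec]
    · omega
    · simp only [BExp.eval, hs' 5 (by decide), h.label _ h0 _ h1, h.label _ h1 _ h0]
  · rw [dataCmd, Cmd.run, Cmd.run, Cmd.run_arr (b := 8) (by decide),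
      run_bulk (g := fun p q => ∑ v ∈ Finset.range N,
        if s.arr 3 (N * v + p) ≠ 0 then s.arr 3 (N * v + q) else 0) (fun s' hs' h0 h1 => ?_)
      (lt p) (lt q)]
    · rw [Ne, Finset.sum_eq_zero_iff]
      simp only [Finset.mem_range, not_forall]
      constructor
      · rintro ⟨v, hv, h1⟩
        rw [h.matrix_fin hm hv, h.matrix_fin hm hv] at h1
        by_cases c1 : ∃ h : v < n, (⟨v, h⟩ : Fin n) ∈ E.supp p
        · by_cases c2 : ∃ h : v < n, (⟨v, h⟩ : Fin n) ∈ E.supp q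
          · exact ⟨⟨v, c1.1⟩, Finset.mem_inter.2 ⟨c1.2, c2.2⟩⟩
          · simp [c2] at h1
        · simp [c1] at h1
      · rintro ⟨v, hv⟩
        obtain ⟨h1, h2⟩ := Finset.mem_inter.1 hv
        refine ⟨v, v.2.trans_le hn, ?_⟩
        rw [h.matrix_fin hm (v.2.trans_le hn), h.matrix_fin hm (v.2.trans_le hn)]
        simp [h1, h2]
    · have h3 : s'.arr 3 = s.arr 3 := (hs' 3 (by decide)).trans (Cmd.run_arr (by decide) s)
      simp only [BExp.eval, h3, setVar_var, setVar_arr, if_true, if_false,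
        show (0 : ℕ) ≠ 2 by decide, show (1 : ℕ) ≠ 2 by decide]
  · rw [dataCmd, Cmd.run, Cmd.run,
      run_bulk (g := fun p q => ∑ v ∈ Finset.range N,
        (s.arr 3 (N * v + q) - s.arr 3 (N * v + p))) (fun s' hs' h0 h1 => ?_)
      (lt p) (lt q)]
    · rw [← sum_range_eq_card hn]
      refine Finset.sum_congr rfl fun v hv => ?_
      rw [h.matrix_fin hm (Finset.mem_range.1 hv), h.matrix_fin hm (Finset.mem_range.1 hv)]
      by_cases c0 : v < n
      · by_cases c1 : (⟨v, c0⟩ : Fin n) ∈ E.supp p <;>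
          by_cases c2 : (⟨v, c0⟩ : Fin n) ∈ E.supp q <;>
          simp [c0, c1, c2]
      · simp [c0]
    · have h3 : s'.arr 3 = s.arr 3 := (hs' 3 (by decide)).trans
        ((Cmd.run_arr (by decide) _).trans (Cmd.run_arr (by decide) s))
      simp only [BExp.eval, lackExp, h3, setVar_var, setVar_arr, if_true, if_false,
        show (0 : ℕ) ≠ 3 by decide, show (1 : ℕ) ≠ 3 by decide]

end Election

/-! ### The program of the dynamic program -/

namespace Election

open RAM

variable {n m : ℕ} {E : Election (Fin n) (Fin m)} {N : ℕ} {r : Fin m → Fin m → Prop}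
  {S : Finset (Fin m)}

/-- Array `1` marks the members of `S`. -/
def Marks (N : ℕ) (S : Finset (Fin m)) (a : ℕ → ℕ → ℕ) : Prop :=
  ∀ c < N, a 1 c ≠ 0 ↔ ∃ h : c < m, (⟨c, h⟩ : Fin m) ∈ S

/-- Array `10` is the table of the dynamic program for committees of `j` undominated
candidates from `S`; rows that belong to no candidate are empty. -/
structure HasTable (E : Election (Fin n) (Fin m)) (N : ℕ) (r : Fin m → Fin m → Prop)
    (S : Finset (Fin m)) (j : ℕ) (a : ℕ → ℕ → ℕ) : Prop where
  table : E.IsTable r (S ∩ E.kept) j fun c s => if s < N then a 10 (N * c + s) else 0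
  lt : ∀ c < N, ∀ s < N, a 10 (N * c + s) ≠ 0 → c < m

theorem HasData.run {s : State} (h : HasData E N r s.arr) {c : Cmd}
    (hc : Disjoint c.arrs {2, 3, 4, 7, 8, 9}) : HasData E N r (c.run N s).arr := by
  have hr : ∀ b ∈ ({2, 3, 4, 7, 8, 9} : Finset ℕ), (c.run N s).arr b = s.arr b := fun b hb =>
    Cmd.run_arr (Finset.disjoint_right.1 hc hb) s
  refine ⟨h.toHasKept.congr (hr 2 (by decide)) (hr 3 (by decide)) (hr 4 (by decide)), ?_, ?_, ?_⟩
  · rw [hr 7 (by decide)]; exact h.order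
  · rw [hr 8 (by decide)]; exact h.common
  · rw [hr 9 (by decide)]; exact h.diff

theorem Marks.run {s : State} (h : Marks N S s.arr) {c : Cmd} (hc : 1 ∉ c.arrs) :
    Marks N S (c.run N s).arr := by
  rw [Marks, Cmd.run_arr hc]
  exact h

theorem exists_of_sup_ne_zero {f : ℕ → ℕ} (h : (Finset.range N).sup f ≠ 0) :
    ∃ i < N, (Finset.range N).sup f = f i := by
  rcases Nat.eq_zero_or_pos N with rfl | hN
  · simp at h
  · obtain ⟨i, h1, h2⟩ := Finset.exists_mem_eq_sup (Finset.range N) ⟨0, by simpa using hN⟩ f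
    exact ⟨i, Finset.mem_range.1 h1, h2⟩

/-- The table for committees with one member. -/
def initExp : BExp :=
  .when (.mat 4 (.var 0) (.const 0)) <| .when (.get 1 (.var 0)) <|
    .whenEq (.var 1) (.sum 2 (.mat 3 (.var 2) (.var 0))) (.add (.const 1) (.pairs (.var 1)))

theorem eval_initExp {s : State} (hn : n ≤ N) (hm : m ≤ N) (h : HasData E N r s.arr)
    (hS : Marks N S s.arr) (h0 : s.var 0 < N) (h1 : s.var 1 < N) :
    (∀ c : Fin m, s.var 0 = c → c ∈ S ∩ E.kept → s.var 1 = (E.supp c).card →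
      initExp.eval N s = 1 + (s.var 1).choose 2) ∧
    (initExp.eval N s ≠ 0 → ∃ c : Fin m, s.var 0 = c ∧ c ∈ S ∩ E.kept ∧
      s.var 1 = (E.supp c).card) := by
  have hN : 0 < N := by omega
  have hkept := h.kept (s.var 0) h0 0 hN
  have hp : (BExp.pairs (.var 1)).eval N s = (s.var 1).choose 2 :=
    BExp.eval_pairs (fun i => by simp [BExp.eval]) h1.le
  have hsum : ∀ c : Fin m, s.var 0 = c →
      (BExp.sum 2 (.mat 3 (.var 2) (.var 0))).eval N s = (E.supp c).card := by
    intro c hc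
    rw [← h.sum_matrix hn hm c, BExp.eval]
    simp [BExp.eval, hc]
  have key : initExp.eval N s = if s.arr 4 (N * s.var 0 + 0) ≠ 0 then
      if s.arr 1 (s.var 0) ≠ 0 then
        if s.var 1 = (BExp.sum 2 (.mat 3 (.var 2) (.var 0))).eval N s then
          1 + (s.var 1).choose 2 else 0 else 0 else 0 := by
    rw [initExp, BExp.eval_when, BExp.eval_when, BExp.eval_whenEq, ← hp]
    rfl
  constructor
  · intro c hc hcS h2
    obtain ⟨k1, k2⟩ := Finset.mem_inter.1 hcS
    rw [key, if_pos, if_pos, if_pos (h2.trans (hsum c hc).symm)]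
    · rw [hc, hS c (c.2.trans_le hm)]
      exact ⟨c.2, k1⟩
    · rw [hkept, hc]
      exact ⟨c.2, k2⟩
  · intro hne
    rw [key] at hne
    by_cases c1 : s.arr 4 (N * s.var 0 + 0) = 0
    · exact absurd (if_neg (not_not.2 c1)) hne
    rw [if_pos c1] at hne
    by_cases c2 : s.arr 1 (s.var 0) = 0
    · exact absurd (if_neg (not_not.2 c2)) hne
    rw [if_pos c2] at hne
    by_cases c3 : s.var 1 = (BExp.sum 2 (.mat 3 (.var 2) (.var 0))).eval N s
    · obtain ⟨hc, h3⟩ := (hS _ h0).1 c2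
      obtain ⟨_, h4⟩ := hkept.1 c1
      exact ⟨⟨s.var 0, hc⟩, rfl, Finset.mem_inter.2 ⟨h3, h4⟩, by rw [← hsum _ rfl, ← c3]⟩
    · exact absurd (if_neg c3) hne

theorem hasTable_initExp {s : State} (hn : n < N) (hm : m ≤ N) (h : HasData E N r s.arr)
    (hS : Marks N S s.arr) : HasTable E N r S 1 ((bulk 10 initExp).run N s).arr := by
  have hb : ∀ c < N, ∀ t < N, ((bulk 10 initExp).run N s).arr 10 (N * c + t) =
      initExp.eval N ((s.setVar 0 c).setVar 1 t) := fun c hc t ht =>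
    run_bulk_eval (by decide) (by decide) hc ht
  have he := fun (c : ℕ) (hc : c < N) (t : ℕ) (ht : t < N) =>
    eval_initExp (s := (s.setVar 0 c).setVar 1 t) (S := S) hn.le hm h hS (by simpa) (by simpa)
  simp only [setVar_var, if_true, zero_ne_one, if_false] at he
  refine ⟨isTable_one (fun c hc => ?_) (fun c t hct => ?_), fun c hc t ht hct => ?_⟩
  · have hcard : (E.supp c).card < N := by
      have := Finset.card_le_univ (E.supp c)
      rw [Fintype.card_fin] at this
      omega
    rw [if_pos hcard, hb _ (c.2.trans_le hm) _ hcard]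
    exact (he c (c.2.trans_le hm) _ hcard).1 c rfl hc rfl
  · by_cases ht : t < N
    · rw [if_pos ht, hb _ (c.2.trans_le hm) _ ht] at hct
      obtain ⟨c', h1, h2, h3⟩ := (he c (c.2.trans_le hm) t ht).2 hct
      obtain rfl : c = c' := Fin.ext h1
      exact ⟨h2, h3⟩
    · exact absurd (if_neg ht) hct
  · rw [hb c hc t ht] at hct
    obtain ⟨c', h1, -⟩ := (he c hc t ht).2 hct
    exact h1 ▸ c'.2

/-- The number of voters that remain connected, for the previous member `2`, the next member `0` and
the class size `3`. -/
def carryExp : BExp := .when (.mat 8 (.var 2) (.var 0)) (.var 3)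

/-- The contribution of the entry `(2, 3)` of the table to the entry `(0, 1)` of the next table. -/
def contribExp : BExp :=
  .when (.mat 10 (.var 2) (.var 3)) <| .when (.mat 7 (.var 2) (.var 0)) <|
    .whenEq (.var 1) (.add carryExp (.mat 9 (.var 2) (.var 0)))
      (.add (.mat 10 (.var 2) (.var 3)) (.sub (.pairs (.var 1)) (.pairs carryExp)))

/-- The next table. -/
def stepExp : BExp :=
  .when (.mat 4 (.var 0) (.const 0)) <| .when (.get 1 (.var 0)) <| .sup 2 <| .sup 3 contribExp

open Classical in
theorem eval_contribExp {s : State} (h : HasData E N r s.arr) {c d : Fin m} (hc : c ∈ E.kept)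
    (hd : d ∈ E.kept) (h0 : s.var 0 = d) (h1 : s.var 1 < N) (h2 : s.var 2 = c) (h3 : s.var 3 < N) :
    contribExp.eval N s =
      if s.arr 10 (N * c + s.var 3) ≠ 0 ∧ r c d ∧ s.var 1 = E.grow c d (s.var 3) then
        s.arr 10 (N * c + s.var 3) + ((s.var 1).choose 2 - (E.carry c d (s.var 3)).choose 2)
      else 0 := by
  have hcarry : ∀ i, carryExp.eval N (s.setVar 9 i) = E.carry c d (s.var 3) := by
    intro i
    have := h.common c d
    simp [carryExp, BExp.eval, carry, h0, h2, ← this]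
  have hcarry' : carryExp.eval N s = E.carry c d (s.var 3) := by
    have := h.common c d
    simp [carryExp, BExp.eval, carry, h0, h2, ← this]
  have hle : E.carry c d (s.var 3) ≤ N := by
    rw [carry]
    split_ifs
    · exact h3.le
    · exact Nat.zero_le _
  have hp : (BExp.pairs (.var 1)).eval N s = (s.var 1).choose 2 :=
    BExp.eval_pairs (fun i => by simp [BExp.eval]) h1.le
  have hp' := BExp.eval_pairs hcarry hle
  have ho := h.order c d hc hd
  rw [contribExp, BExp.eval_when, BExp.eval_when, BExp.eval_whenEq]
  simp only [BExp.eval, hp, hp', hcarry', h0, h2, h.diff, ho]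
  rw [← grow, ite_and, ite_and]

theorem HasTable.step {s : State} (hn : n < N) (hm : m ≤ N) (hr : E.IsOrder r) {j : ℕ}
    (h : HasData E N r s.arr) (hS : Marks N S s.arr) (ht : HasTable E N r S j s.arr) :
    HasTable E N r S (j + 1)
      ((Cmd.seq (bulk 11 stepExp) (bulk 10 (.mat 11 (.var 0) (.var 1)))).run N s).arr := by
  have hN : 0 < N := by omega
  have hb : ∀ c < N, ∀ t < N, ((Cmd.seq (bulk 11 stepExp)
      (bulk 10 (.mat 11 (.var 0) (.var 1)))).run N s).arr 10 (N * c + t) =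
      stepExp.eval N ((s.setVar 0 c).setVar 1 t) := by
    intro c hc t ht
    rw [Cmd.run, run_bulk_eval (by decide) (by decide) hc ht]
    simp only [BExp.eval, setVar_var, setVar_arr, if_true, zero_ne_one, if_false]
    exact run_bulk_eval (by decide) (by decide) hc ht
  generalize ((Cmd.seq (bulk 11 stepExp) (bulk 10 (.mat 11 (.var 0) (.var 1)))).run N s).arr = a
    at hb
  -- Positive entries come from an entry of the previous table.
  have hB : ∀ d < N, ∀ t < N, a 10 (N * d + t) ≠ 0 → ∃ (d' c : Fin m) (u : ℕ), d = d' ∧ u < N ∧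
      d' ∈ S ∩ E.kept ∧ s.arr 10 (N * c + u) ≠ 0 ∧ r c d' ∧ t = E.grow c d' u ∧
      a 10 (N * d + t) = s.arr 10 (N * c + u) + (t.choose 2 - (E.carry c d' u).choose 2) := by
    intro d hd t htN hne
    rw [hb d hd t htN] at hne ⊢
    rw [stepExp] at hne ⊢
    rw [BExp.eval] at hne ⊢
    by_cases c1 : (BExp.mat 4 (.var 0) (.const 0)).eval N ((s.setVar 0 d).setVar 1 t) = 0
    · exact absurd (if_neg (not_not.2 c1)) hne
    rw [if_pos c1, BExp.eval] at hne ⊢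
    by_cases c2 : (BExp.get 1 (.var 0)).eval N ((s.setVar 0 d).setVar 1 t) = 0
    · exact absurd (if_neg (not_not.2 c2)) hne
    rw [if_pos c2, BExp.eval] at hne ⊢
    obtain ⟨c, hc, e1⟩ := exists_of_sup_ne_zero hne
    rw [e1] at hne ⊢
    rw [BExp.eval] at hne ⊢
    obtain ⟨u, hu, e2⟩ := exists_of_sup_ne_zero hne
    rw [e2] at hne ⊢
    have c3 : s.arr 10 (N * c + u) ≠ 0 := by
      intro c3
      refine hne ?_
      rw [contribExp, BExp.eval_when, if_neg]
      simp [BExp.eval, c3]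
    have hcm := ht.lt c hc u hu c3
    have c3' := ht.table.sound ⟨c, hcm⟩ u
    simp only [if_pos hu] at c3'
    obtain ⟨W, U, hW, -, hE, -⟩ := c3' c3
    have hck := (Finset.mem_inter.1 (hW hE.mem)).2
    simp only [BExp.eval, setVar_var, setVar_arr, if_true, zero_ne_one, if_false] at c1 c2
    obtain ⟨hdm, hdk⟩ := (h.kept d hd 0 hN).1 c1
    obtain ⟨_, hdS⟩ := (hS d hd).1 c2
    have hev := eval_contribExp (s := (((s.setVar 0 d).setVar 1 t).setVar 2 c).setVar 3 u)
      (r := r) h hck hdk (by simp) (by simpa) (by simp) (by simpa)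
    rw [hev] at hne ⊢
    by_cases c4 : s.arr 10 (N * c + u) ≠ 0 ∧ r ⟨c, hcm⟩ ⟨d, hdm⟩ ∧ t = E.grow ⟨c, hcm⟩ ⟨d, hdm⟩ u
    · refine ⟨⟨d, hdm⟩, ⟨c, hcm⟩, u, rfl, hu, Finset.mem_inter.2 ⟨hdS, hdk⟩, c3, c4.2.1, c4.2.2, ?_⟩
      exact if_pos c4
    · exact absurd (if_neg c4) hne
  refine ⟨ht.table.succ hr Finset.inter_subset_right ?_ ?_, fun d hd t htN hne => ?_⟩
  · intro c d u hd hcu hcd hu hg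
    rw [Fintype.card_fin] at hu hg
    have huN : u < N := by omega
    have hgN : E.grow c d u < N := by omega
    have hdN := d.2.trans_le hm
    have hcN := c.2.trans_le hm
    simp only [if_pos huN, if_pos hgN] at hcu ⊢
    obtain ⟨W, U, hW, -, hE, -⟩ := ht.table.sound c u (by simpa only [if_pos huN] using hcu)
    have hck := (Finset.mem_inter.1 (hW hE.mem)).2
    obtain ⟨hdS, hdk⟩ := Finset.mem_inter.1 hd
    rw [hb _ hdN _ hgN, stepExp, BExp.eval, if_pos, BExp.eval, if_pos, BExp.eval]
    · refine le_trans ?_ (Finset.le_sup (Finset.mem_range.2 hcN))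
      rw [BExp.eval]
      refine le_trans ?_ (Finset.le_sup (Finset.mem_range.2 huN))
      have hev := eval_contribExp
        (s := (((s.setVar 0 d).setVar 1 (E.grow c d u)).setVar 2 c).setVar 3 u)
        (r := r) h hck hdk (by simp) (by simpa) (by simp) (by simpa)
      rw [hev, if_pos]
      · rfl
      · exact ⟨hcu, hcd, rfl⟩
    · simp only [BExp.eval, setVar_var, setVar_arr, if_true, zero_ne_one, if_false]
      exact (hS d hdN).2 ⟨d.2, hdS⟩
    · simp only [BExp.eval, setVar_var, setVar_arr, if_true, zero_ne_one, if_false]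
      exact (h.kept d hdN 0 hN).2 ⟨d.2, hdk⟩
  · intro d t hdt
    by_cases htN : t < N
    · simp only [if_pos htN] at hdt ⊢
      obtain ⟨d', c, u, e, hu, k1, k2, k3, k4, k5⟩ := hB d (d.2.trans_le hm) t htN hdt
      obtain rfl : d = d' := Fin.ext e
      exact ⟨c, u, k1, by simpa only [if_pos hu] using k2, k3, k4, by
        rw [← k4]; simpa only [if_pos hu] using k5⟩
    · exact absurd (if_neg htN) hdt
  · obtain ⟨d', -, -, e, -⟩ := hB d hd t htN hne
    exact e ▸ d'.2

/-- The largest entry of the table. -/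
def tableSup : BExp := .sup 2 (.sup 3 (.mat 10 (.var 2) (.var 3)))

/-- Update the optimum, stored with offset `1` in array `12`, by the table for committees of
`j + 1` candidates, where `j` is the variable `10`. -/
def bestCmd : Cmd :=
  .put 12 (.const 0) (.ite (.lt (.var 10) (.get 2 (.const 2)))
    (.maxOf (.get 12 (.const 0)) tableSup) (.get 12 (.const 0)))

/-- Compute the largest number of pairs connected by at most `k` undominated marked candidates. -/
def dynamicCmd : Cmd :=
  .seq (bulk 10 initExp) <| .seq (.put 12 (.const 0) (.const 1)) <| .forN 10 <|
    .seq bestCmd (.seq (bulk 11 stepExp) (bulk 10 (.mat 11 (.var 0) (.var 1))))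

theorem HasTable.tableSup {s : State} (hn : n < N) (hm : m ≤ N) {j : ℕ}
    (ht : HasTable E N r S (j + 1) s.arr) : E.best (S ∩ E.kept) (j + 1) + 1 =
      max (E.best (S ∩ E.kept) j + 1) (tableSup.eval N s) := by
  refine ht.table.best_succ (fun c u hu => ?_) fun hne => ?_
  · rw [Fintype.card_fin] at hu
    rw [if_pos (by omega), Election.tableSup, BExp.eval]
    refine le_trans ?_ (Finset.le_sup (Finset.mem_range.2 (c.2.trans_le hm)))
    rw [BExp.eval]
    refine le_trans ?_ (Finset.le_sup (Finset.mem_range.2 (show u < N by omega)))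
    simp [BExp.eval]
  · rw [Election.tableSup, BExp.eval] at hne ⊢
    obtain ⟨c, hc, e1⟩ := exists_of_sup_ne_zero hne
    rw [e1] at hne ⊢
    rw [BExp.eval] at hne ⊢
    obtain ⟨u, hu, e2⟩ := exists_of_sup_ne_zero hne
    rw [e2] at hne ⊢
    have e3 : (BExp.mat 10 (.var 2) (.var 3)).eval N ((s.setVar 2 c).setVar 3 u) =
        s.arr 10 (N * c + u) := by simp [BExp.eval]
    rw [e3] at hne ⊢
    exact ⟨⟨c, ht.lt c hc u hu hne⟩, u, (if_pos hu).symm⟩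

theorem run_dynamicCmd {s : State} (hn : n < N) (hm : m ≤ N) (hr : E.IsOrder r)
    (h : HasData E N r s.arr) (hS : Marks N S s.arr) :
    (dynamicCmd.run N s).arr 12 0 = E.best (S ∩ E.kept) E.k + 1 := by
  have hk : min N E.k = E.k := min_eq_right (by
    have := E.k_le
    rw [Fintype.card_fin] at this
    omega)
  let I : ℕ → State → Prop := fun j s => HasData E N r s.arr ∧ Marks N S s.arr ∧
    HasTable E N r S (j + 1) s.arr ∧ s.arr 12 0 = E.best (S ∩ E.kept) (min j E.k) + 1
  have := iter_induction I (N := N) (s := Cmd.run N (.put 12 (.const 0) (.const 1))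
    ((bulk 10 initExp).run N s)) (f := fun j s => Cmd.run N (.seq bestCmd (.seq (bulk 11 stepExp)
    (bulk 10 (.mat 11 (.var 0) (.var 1))))) (s.setVar 10 j)) ?_ ?_
  · have h4 := this.2.2.2
    rwa [hk] at h4
  · have ht := hasTable_initExp hn hm h hS
    refine ⟨(h.run (by decide)).run (c := .put 12 (.const 0) (.const 1)) (by decide),
      (hS.run (by decide)).run (c := .put 12 (.const 0) (.const 1)) (by decide), ?_, ?_⟩
    · have e : (Cmd.run N (.put 12 (.const 0) (.const 1)) ((bulk 10 initExp).run N s)).arr 10 =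
        ((bulk 10 initExp).run N s).arr 10 := Cmd.run_arr (by decide) _
      exact ⟨by rw [e]; exact ht.table, by rw [e]; exact ht.lt⟩
    · rw [Cmd.run, BExp.eval, BExp.eval, setArr_arr_self, if_pos rfl, Nat.zero_min, best_zero]
  · rintro j hj s1 ⟨h1, h2, h3, h4⟩
    have e : (bestCmd.run N (s1.setVar 10 j)).arr 10 = s1.arr 10 :=
      Cmd.run_arr (by decide) (s1.setVar 10 j)
    have k1 : HasData E N r (bestCmd.run N (s1.setVar 10 j)).arr :=
      HasData.run (s := s1.setVar 10 j) h1 (by decide)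
    have k2 : Marks N S (bestCmd.run N (s1.setVar 10 j)).arr :=
      Marks.run (s := s1.setVar 10 j) h2 (by decide)
    have k3 : HasTable E N r S (j + 1) (bestCmd.run N (s1.setVar 10 j)).arr :=
      ⟨by rw [e]; exact h3.table, by rw [e]; exact h3.lt⟩
    refine ⟨k1.run (by decide), k2.run (by decide), k3.step hn hm hr k1 k2, ?_⟩
    rw [Cmd.run, Cmd.run_arr (by decide), bestCmd, Cmd.run, BExp.eval, setArr_arr_self, if_pos rfl]
    simp only [BExp.eval, BExp.eval_maxOf, setVar_var, setVar_arr, if_true, h4, h1.k_eq]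
    by_cases hjk : j < E.k
    · rw [if_pos (by omega), min_eq_left hjk.le, min_eq_left (show j + 1 ≤ E.k from hjk)]
      exact (HasTable.tableSup (s := s1.setVar 10 j) hn hm h3).symm
    · rw [if_neg (by omega), min_eq_right (by omega), min_eq_right (by omega)]

end Election

/-! ### Removing superfluous candidates -/

namespace Election

open RAM Consecutive

variable {n m : ℕ} {E : Election (Fin n) (Fin m)} {N : ℕ} {r : Fin m → Fin m → Prop}
  {S : Finset (Fin m)}

/-- Mark all candidates. -/
def markAllCmd : Cmd := bulk 1 (.ite (.lt (.var 1) (.get 2 (.const 1))) (.const 1) (.const 0))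

/-- Whether the candidate `11`, which has just been unmarked, has to be marked again: the optimum
for the remaining ones (array `12`) is smaller than the optimum for all candidates (array `13`), or
fewer than `k` candidates remain. -/
def restoreExp : BExp :=
  .when (.lt (.var 11) (.get 2 (.const 1))) <|
    .ite (.lt (.get 12 (.const 0)) (.get 13 (.const 0))) (.const 1) <|
      .lt (.sum 2 (.ite (.get 1 (.var 2)) (.const 1) (.const 0))) (.get 2 (.const 2))

/-- Unmark candidate `11` if this is possible. -/
def removeCmd : Cmd :=
  .seq (.put 1 (.var 11) (.const 0)) (.seq dynamicCmd (.put 1 (.var 11) restoreExp))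

/-- Mark all candidates, store the optimum, and try to unmark each candidate in turn. -/
def selectCmd : Cmd :=
  .seq markAllCmd <| .seq dynamicCmd <| .seq (.put 13 (.const 0) (.get 12 (.const 0))) <|
    .forN 11 removeCmd

theorem Marks.sum_eq {a : ℕ → ℕ → ℕ} (h : Marks N S a) (hm : m ≤ N) :
    ∑ c ∈ Finset.range N, (if a 1 c ≠ 0 then 1 else 0) = S.card := by
  classical
  rw [← sum_range_eq_card hm S]
  refine Finset.sum_congr rfl fun c hc => ?_
  simp only [h c (Finset.mem_range.1 hc)]

theorem Marks.put {s : State} (h : Marks N S s.arr) {T : Finset (Fin m)} {i y : ℕ}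
    (hT : ∀ c : Fin m, (c : ℕ) ≠ i → (c ∈ T ↔ c ∈ S))
    (hi : y ≠ 0 ↔ ∃ h : i < m, (⟨i, h⟩ : Fin m) ∈ T) : Marks N T (s.setArr 1 i y).arr := by
  intro c hc
  rw [setArr_arr_self]
  split_ifs with hci
  · rw [hci, hi]
  · rw [h c hc]
    exact exists_congr fun hcm => (hT ⟨c, hcm⟩ hci).symm

/-- The marked set `S` still contains an optimal committee and has at least `k` members, and none of
its members with an index below `i` can be removed without losing one of these properties. -/
structure Reduced (E : Election (Fin n) (Fin m)) (i : ℕ) (S : Finset (Fin m)) : Prop where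
  card : E.k ≤ S.card
  best : E.best (S ∩ E.kept) E.k = E.best E.kept E.k
  minimal : ∀ c ∈ S, (c : ℕ) < i → E.best (S.erase c ∩ E.kept) E.k < E.best E.kept E.k ∨
    (S.erase c).card < E.k

theorem Reduced.succ_self {i : ℕ} (h : Reduced E i S)
    (hi : ∀ c ∈ S, (c : ℕ) = i → E.best (S.erase c ∩ E.kept) E.k < E.best E.kept E.k ∨
      (S.erase c).card < E.k) : Reduced E (i + 1) S :=
  ⟨h.card, h.best, fun c hc hci => by
    rcases Nat.lt_succ_iff_lt_or_eq.1 hci with hci | hci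
    · exact h.minimal c hc hci
    · exact hi c hc hci⟩

theorem Reduced.succ_erase {c : Fin m} (h : Reduced E c S)
    (h1 : ¬E.best (S.erase c ∩ E.kept) E.k < E.best E.kept E.k)
    (h2 : ¬(S.erase c).card < E.k) : Reduced E (c + 1) (S.erase c) := by
  refine ⟨not_lt.1 h2, le_antisymm (best_mono _ Finset.inter_subset_right) (not_lt.1 h1),
    fun d hd hdc => ?_⟩
  obtain ⟨hne, hdS⟩ := Finset.mem_erase.1 hd
  have hlt : (d : ℕ) < c := by
    have := Fin.val_ne_of_ne hne
    omega
  have hsub : (S.erase c).erase d ⊆ S.erase d :=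
    Finset.erase_subset_erase _ (Finset.erase_subset _ _)
  refine (h.minimal d hdS hlt).imp (fun h => lt_of_le_of_lt ?_ h) fun h => lt_of_le_of_lt ?_ h
  · exact best_mono _ (Finset.inter_subset_inter_right hsub)
  · exact Finset.card_le_card hsub

theorem run_removeCmd {s : State} (hn : n < N) (hm : m ≤ N) (hr : E.IsOrder r)
    (h : HasData E N r s.arr) (hS : Marks N S s.arr) (hred : Reduced E (s.var 11) S)
    (h13 : s.arr 13 0 = E.best E.kept E.k + 1) :
    HasData E N r (removeCmd.run N s).arr ∧ (removeCmd.run N s).arr 13 = s.arr 13 ∧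
      ∃ T, Marks N T (removeCmd.run N s).arr ∧ Reduced E (s.var 11 + 1) T := by
  refine ⟨h.run (by decide), Cmd.run_arr (by decide) s, ?_⟩
  generalize hi : s.var 11 = i at hred
  -- The state after unmarking, and the state after the dynamic program.
  obtain ⟨s1, e1⟩ : ∃ s1, s1 = Cmd.run N (.put 1 (.var 11) (.const 0)) s := ⟨_, rfl⟩
  obtain ⟨s2, e2⟩ : ∃ s2, s2 = dynamicCmd.run N s1 := ⟨_, rfl⟩
  have hrun : removeCmd.run N s = s2.setArr 1 i (restoreExp.eval N s2) := by
    have hv : s2.var 11 = i := by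
      rw [e2, Cmd.run_var (by decide), e1, Cmd.run_var (by decide), hi]
    have : removeCmd.run N s = s2.setArr 1 (s2.var 11) (restoreExp.eval N s2) := by
      rw [e2, e1]
      rfl
    rw [this, hv]
  have d1 : HasData E N r s1.arr := e1 ▸ h.run (by decide)
  have d2 : HasData E N r s2.arr := e2 ▸ d1.run (by decide)
  let S' : Finset (Fin m) := S.filter fun c => (c : ℕ) ≠ i
  have m1 : Marks N S' s1.arr := by
    rw [e1, Cmd.run]
    refine hS.put (fun c hc => ?_) ?_
    · simp only [BExp.eval, hi] at hc
      simp [S', hc]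
    · simp [BExp.eval, S', hi]
  have m2 : Marks N S' s2.arr := e2 ▸ m1.run (by decide)
  have h12 : s2.arr 12 0 = E.best (S' ∩ E.kept) E.k + 1 := e2 ▸ run_dynamicCmd hn hm hr d1 m1
  have h13' : s2.arr 13 0 = E.best E.kept E.k + 1 := by
    rw [e2, Cmd.run_arr (by decide), e1, Cmd.run_arr (by decide), h13]
  have hv : s2.var 11 = i := by
    rw [e2, Cmd.run_var (by decide), e1, Cmd.run_var (by decide), hi]
  have hval : restoreExp.eval N s2 ≠ 0 ↔ i < m ∧
      (E.best (S' ∩ E.kept) E.k < E.best E.kept E.k ∨ S'.card < E.k) := by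
    rw [restoreExp, BExp.eval_when]
    simp only [BExp.eval, setVar_var, setVar_arr, if_true, h12, h13', d2.m_eq, d2.k_eq,
      m2.sum_eq hm, hv]
    by_cases c1 : i < m
    · rw [if_pos (by omega)]
      split_ifs <;> simp only [c1, true_and] <;> omega
    · rw [if_neg (by omega)]
      simp [c1]
  rw [hrun]
  by_cases him : i < m
  · have hS' : S' = S.erase ⟨i, him⟩ := by
      ext c
      simp [S', Fin.ext_iff, and_comm]
    by_cases hv : restoreExp.eval N s2 = 0
    · refine ⟨S', m2.put (fun c _ => Iff.rfl) ?_, ?_⟩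
      · simp [hv, S']
      · rw [← not_iff_not, not_ne_iff, not_and_or, not_or] at hval
        obtain ⟨k1, k2⟩ := (hval.1 hv).resolve_left (not_not.2 him)
        rw [hS'] at k1 k2 ⊢
        exact Reduced.succ_erase (c := ⟨i, him⟩) hred k1 k2
    · obtain ⟨-, hor⟩ := hval.1 hv
      have hiS : (⟨i, him⟩ : Fin m) ∈ S := by
        by_contra hno
        rw [hS', Finset.erase_eq_of_notMem hno, hred.best] at hor
        have := hred.card
        omega
      refine ⟨S, m2.put (fun c hc => ?_) ?_, hred.succ_self fun c hc hci => ?_⟩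
      · simp [S', hc]
      · exact ⟨fun _ => ⟨him, hiS⟩, fun _ => hv⟩
      · obtain rfl : c = ⟨i, him⟩ := Fin.ext hci
        rwa [hS'] at hor
  · have hSS : S' = S := Finset.filter_true_of_mem fun c _ => by omega
    refine ⟨S, m2.put (fun c _ => by rw [hSS]) ?_, hred.succ_self fun c _ hci => ?_⟩
    · rw [hval]
      exact ⟨fun h => absurd h.1 him, fun h => absurd h.1 him⟩
    · exact absurd (hci ▸ c.2) him

theorem run_selectCmd {s : State} (hn : n < N) (hm : m ≤ N) (hr : E.IsOrder r)
    (h : HasData E N r s.arr) :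
    ∃ S, Marks N S (selectCmd.run N s).arr ∧ E.IsConsMaximizing S := by
  let I : ℕ → State → Prop := fun i s => HasData E N r s.arr ∧
    s.arr 13 0 = E.best E.kept E.k + 1 ∧ ∃ S, Marks N S s.arr ∧ Reduced E i S
  obtain ⟨s1, e1⟩ : ∃ s1, s1 = markAllCmd.run N s := ⟨_, rfl⟩
  obtain ⟨s2, e2⟩ : ∃ s2, s2 = dynamicCmd.run N s1 := ⟨_, rfl⟩
  have d1 : HasData E N r s1.arr := e1 ▸ h.run (by decide)
  have d2 : HasData E N r s2.arr := e2 ▸ d1.run (by decide)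
  have m1 : Marks N (Finset.univ : Finset (Fin m)) s1.arr := by
    intro c hc
    have := run_bulk_eval (N := N) (a := 1) (e := .ite (.lt (.var 1) (.get 2 (.const 1))) (.const 1)
      (.const 0)) (s := s) (by decide) (by decide) (show 0 < N by omega) hc
    rw [mul_zero, zero_add] at this
    rw [e1, markAllCmd, this]
    simp only [BExp.eval, setVar_var, setVar_arr, if_true, h.m_eq]
    by_cases hcm : c < m
    · rw [if_pos (by omega)]
      simp [hcm]
    · rw [if_neg (by omega)]
      simp [hcm]
  have m2 : Marks N (Finset.univ : Finset (Fin m)) s2.arr := e2 ▸ m1.run (by decide)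
  have h12 : s2.arr 12 0 = E.best E.kept E.k + 1 := by
    have := run_dynamicCmd hn hm hr d1 m1
    rwa [← e2, Finset.univ_inter] at this
  have hrun : selectCmd.run N s = Cmd.run N (.forN 11 removeCmd)
      (Cmd.run N (.put 13 (.const 0) (.get 12 (.const 0))) s2) := by
    rw [e2, e1]
    rfl
  have h0 : I 0 (Cmd.run N (.put 13 (.const 0) (.get 12 (.const 0))) s2) := by
    refine ⟨d2.run (by decide), ?_, Finset.univ, m2.run (by decide), ?_, ?_, ?_⟩
    · simp [Cmd.run, BExp.eval, setArr_arr_self, h12]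
    · rw [Finset.card_univ]
      exact E.k_le
    · rw [Finset.univ_inter]
    · exact fun c _ hc => absurd hc (Nat.not_lt_zero _)
  have hN := iter_induction I (N := N) (f := fun i s => removeCmd.run N (s.setVar 11 i)) h0 (by
    rintro i - s3 ⟨k1, k2, S, k3, k4⟩
    obtain ⟨l1, l2, T, l3, l4⟩ := run_removeCmd (s := s3.setVar 11 i) hn hm hr k1 k3
      (by simpa using k4) k2
    exact ⟨l1, by rw [l2]; exact k2, T, l3, by simpa using l4⟩)
  obtain ⟨-, -, S, k1, k2⟩ := hN
  rw [hrun]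
  exact ⟨S, k1, isConsMaximizing_of_minimal k2.card k2.best fun c hc =>
    k2.minimal c hc (c.2.trans_le hm)⟩

/-! ### The machine program -/

/-- The whole computation, for a bound `N` larger than the numbers of voters and candidates. -/
def solveCmd : Cmd :=
  .seq matrixCmd <| .seq keptCmd <| .seq labelCmd <| .seq dataCmd selectCmd

theorem run_solveCmd {s : State} (hE : E.IsVCI) (hn : n < N) (hm : m ≤ N)
    (h0 : s.arr 0 = E.input.arr 0) (h1 : s.arr 2 0 = n) (h2 : s.arr 2 1 = m)
    (h3 : s.arr 2 2 = E.k) :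
    ∃ S, Marks N S (solveCmd.run N s).arr ∧ E.IsConsMaximizing S :=
  run_selectCmd hn hm (hE.isOrder_of_isLabel hm (isLabel_label hm (by omega)))
    (hasData_dataCmd hn.le hm (hasLabel_labelCmd hn.le
      (hasKept_keptCmd hn.le hm (hasApprovals_matrixCmd hm h0 h1 h2 h3))))

/-- The machine program: store `n`, `m`, `k` in array `2` and the bound `n + m + 1` in the variable
`1`, and run the compiled computation. -/
def solveProg : Prog :=
  .seq (.put 2 (.const 0) (.var 0)) <| .seq (.put 2 (.const 1) (.var 1)) <|
    .seq (.put 2 (.const 2) (.var 2)) <|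
      .seq (.assign 1 (.add (.add (.var 0) (.var 1)) (.const 1))) (solveCmd.compile 0)

theorem runs_solveProg (hE : E.IsVCI) :
    Runs solveProg E.input (9 + (6 + solveCmd.cost.eval (n + m + 1))) fun s =>
      E.IsConsMaximizing (output m s) := by
  let σ : State := (((E.input.setArr 2 0 n).setArr 2 1 m).setArr 2 2 E.k).setVar 1 (n + m + 1)
  let s : State := ⟨fun x => σ.var (2 * x), σ.arr⟩
  have hrep : Rep (n + m + 1) s σ := ⟨fun _ => rfl, rfl, by simp [σ]⟩
  obtain ⟨S, h1, h2⟩ := run_solveCmd (N := n + m + 1) (s := s) hE (by omega) (by omega)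
    (by simp [s, σ, setArr_arr_ne]) (by simp [s, σ, setArr_arr_self])
    (by simp [s, σ, setArr_arr_self]) (by simp [s, σ, setArr_arr_self])
  have hfin : Runs (solveCmd.compile 0) σ (solveCmd.cost.eval (n + m + 1)) fun s =>
      E.IsConsMaximizing (output m s) := by
    refine (solveCmd.runs_compile (n + m + 1) 0 s σ hrep).mono le_rfl fun σ' hσ' => ?_
    have : output m σ' = S := by
      ext c
      rw [output, Finset.mem_filter, hσ'.rep.arr, h1 c (by omega)]
      simp
    rwa [this]
  have hbound : Runs (.seq (.assign 1 (.add (.add (.var 0) (.var 1)) (.const 1)))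
      (solveCmd.compile 0)) (((E.input.setArr 2 0 n).setArr 2 1 m).setArr 2 2 E.k) _ _ :=
    Runs.seq (Runs.assign (Q := fun s => s = σ) rfl) (by rintro _ rfl; exact hfin)
  have h2 := Runs.seq (Runs.put (s := (E.input.setArr 2 0 n).setArr 2 1 m) (a := 2)
    (i := .const 2) (e := .var 2) (Q := fun s => s = _) rfl) (by rintro _ rfl; exact hbound)
  have h1 := Runs.seq (Runs.put (s := E.input.setArr 2 0 n) (a := 2)
    (i := .const 1) (e := .var 1) (Q := fun s => s = _) rfl) (by rintro _ rfl; exact h2)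
  have h0 := Runs.seq (Runs.put (s := E.input) (a := 2)
    (i := .const 0) (e := .var 0) (Q := fun s => s = _) rfl) (by rintro _ rfl; exact h1)
  refine h0.le ?_
  simp only [Exp.cost]
  omega

end Election

theorem mainTheorem1 :
    ∃ (P : RAM.Prog) (p : Polynomial ℕ),
      ∀ (n m : ℕ) (E : Election (Fin n) (Fin m)), E.IsVCI →
        ∃ (s : RAM.State) (t : ℕ),
          RAM.Exec P E.input s t ∧ t ≤ p.eval (n + m) ∧
            E.IsConsMaximizing (Election.output m s) := by
  refine ⟨Election.solveProg, Election.solveCmd.cost.comp (Polynomial.X + 1) + 15,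
    fun n m E hE => ?_⟩
  obtain ⟨s, t, h1, h2, h3⟩ := Election.runs_solveProg hE
  refine ⟨s, t, h1, h2.trans ?_, h3⟩
  simp only [Polynomial.eval_add, Polynomial.eval_comp, Polynomial.eval_X, Polynomial.eval_one,
    Polynomial.eval_ofNat]
  omega
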